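/- Let $q$ be a prime power and let $n$ be a prime power with $q\ge n>2$. Denote by $(v)_{\mathbb F}$ the projective point with homogeneous coordinate vector $v$ over the field $\mathbb F$. Write the points of $\mathrm{PG}(2,q^n)$ as $(a,b,c)_{\mathbb F_{q^n}}$ with $a,b,c\in\mathbb F_{q^n}$, and let $l_\infty$ be the line $c=0$. Write the points of $\mathrm{PG}(2n,q)$ as $(a,b,c)_{\mathbb F_q}$ with $a,b\in\mathbb F_{q^n}$, $c\in\mathbb F_q$, and let $H_\infty$ be the hyperplane $c=0$; points not on $H_\infty$ are called affine. The ABB-map sends $(a,b,1)_{\mathbb F_{q^n}}$ to $(a,b,1)_{\mathbb F_q}$ and $(a,b,0)_{\mathbb F_{q^n}}$ to $\{(ax,bx,0)_{\mathbb F_q}: x\in\mathbb F_{q^n}^*\}$. For a divisor $k$ of $n$, an $\mathbb F_{q^k}$-subline of $\mathrm{PG}(2,q^n)$ is a set $\{(su+tv)_{\mathbb F_{q^n}}: (s,t)\in\mathbb F_{q^k}^2\setminus\{(0,0)\}\}$ with $u,v\in\mathbb F_{q^n}^3$ linearly independent over $\mathbb F_{q^n}$; it is external (respectively tangent) to $l_\infty$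 if it has no point (respectively exactly one point) on $l_\infty$. The smallest of a set of sublines is the one over the smallest field. Let $\mathcal D_k$ be the Desarguesian $(k-1)$-spread of $H_\infty$ with elements $\{(ax,bx,0)_{\mathbb F_q}: x\in\mathbb F_{q^k}^*\}$, $(a,b)\in\mathbb F_{q^n}^2\setminus\{(0,0)\}$. Embed $\mathrm{PG}(2n,q)$ in $\mathrm{PG}(2n,q^n)$ by the map induced by $\iota(a,b,c)=(a,a^q,\dots,a^{q^{n-1}};b,b^q,\dots,b^{q^{n-1}};c)$, and let $\sigma$ be the collineation of $\mathrm{PG}(2n,q^n)$ sending $(a_0,\dots,a_{n-1};b_0,\dots,b_{n-1};c)$ to $(a_{n-1}^q,a_0^q,\dots,a_{n-2}^q;b_{n-1}^q,b_0^q,\dots,b_{n-2}^q;c^q)$. Let $\nu$ be the line consisting of the points all of whose coordinates other than $a_0$ and $b_0$ vanish. The indicator set of $\mathcal D_k$ is $\{\Pi,\Pi^\sigma,\dots,\Pi^{\sigma^{k-1}}\}$, where $\Pi=\langle \nu,\nu^{\sigma^k},\dots,\nu^{\sigma^{n-k}}\rangle\cap\mathrm{Fix}(\sigma^k)$. A normal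 rational curve of degree $r$ in $\mathrm{PG}(2n,q)$ is a set $\mathcal C=\{(\sum_{i=0}^r s^{r-i}t^ie_i)_{\mathbb F_q}: (s,t)\in\mathbb F_q^2\setminus\{(0,0)\}\}$ with $e_0,\dots,e_r$ linearly independent over $\mathbb F_q$; its $\mathbb F_{q^n}$-extension $\mathcal C^*$, for such a parametrisation, is $\{(\sum_{i=0}^r s^{r-i}t^i\iota(e_i))_{\mathbb F_{q^n}}: (s,t)\in\mathbb F_{q^n}^2\setminus\{(0,0)\}\}$. Say that $\mathcal C$ is of type $(*)_r$ if, for some such parametrisation, the points of $\mathcal C^*$ on the members of the indicator set of $\mathcal D_r$ are exactly $r$ distinct conjugate points $Q,Q^\sigma,\dots,Q^{\sigma^{r-1}}$. Let $k$ and $r$ be divisors of $n$, and let $M$ be a set of $q^k+1$ affine points of $\mathrm{PG}(2n,q)$. Then $M$ is the image under the ABB-map of an $\mathbb F_{q^k}$-subline $m$ of $\mathrm{PG}(2,q^n)$ that is external to $l_\infty$ and such that the smallest subline containing $m$ and tangent to $l_\infty$ is an $\mathbb F_{q^r}$-subline, if and only if (i) the point set $M$ spans an $r$-space intersecting $H_\infty$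 in an element of $\mathcal D_r$, and (ii) through every three distinct points of $M$ there is a unique normal rational curve $\mathcal C$ of degree $r$ of type $(*)_r$, and all points of $\mathcal C$ are contained in $M$. -/

import Mathlib

open scoped LinearAlgebra.Projectivization

noncomputable section

namespace ABB

/-! ### Points, subspaces and rational curves in projective spaces -/

section General

variable {R : Type*} [Field R] {V : Type*} [AddCommGroup V] [Module R V]

/-- `v` is a (nonzero) homogeneous coordinate vector of the point `P`, i.e. `P = (v)_R`. -/
def IsCoord (P : ℙ R V) (v : V) : Prop :=
  ∃ h : v ≠ 0, P = Projectivization.mk R v h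

/-- The vector subspace underlying the projective span of a set of points. -/
def spanPts (S : Set (ℙ R V)) : Submodule R V :=
  ⨆ P ∈ S, P.submodule

/-- The point set `{(s^d e_0 + s^(d-1) t e_1 + ⋯ + t^d e_d)_R}`, with `(s, t)` ranging over the
pairs of elements of `R`.  For linearly independent `e_0, …, e_d` it is a normal rational curve
of degree `d`. -/
def ratCurve {d : ℕ} (e : Fin (d + 1) → V) : Set (ℙ R V) :=
  {P | ∃ s t : R, IsCoord P (∑ i : Fin (d + 1), (s ^ (d - (i : ℕ)) * t ^ (i : ℕ)) • e i)}

variable (R) (A : Type*) [AddCommGroup A] [Module R A]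

/-- The hyperplane with equation `c = 0` in the space of triples `(a, b, c)`, `a, b ∈ A`,
`c ∈ R`. -/
def infinity : Submodule R (A × A × R) :=
  LinearMap.ker ((LinearMap.snd R A R) ∘ₗ (LinearMap.snd R A (A × R)))

end General

variable (F K : Type*) [Field F] [Fintype F] [Field K] [Algebra F K]

/-- With `|F| = q` and `n = [K : F]`: the points of `PG(2, q^n)` are the points `(a, b, c)_K`. -/
abbrev Plane : Type _ := ℙ K (K × K × K)

/-- The points of `PG(2n, q)` are the points `(a, b, c)_F` with `a, b ∈ K` and `c ∈ F`. -/
abbrev Space : Type _ := ℙ F (K × K × F)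

/-- Coordinate vectors `(a_0, …, a_{n-1}; b_0, …, b_{n-1}; c)` over `K`. -/
abbrev StarVec : Type _ :=
  (ZMod (Module.finrank F K) → K) × (ZMod (Module.finrank F K) → K) × K

/-- The points of `PG(2n, q^n)`. -/
abbrev StarSpace : Type _ := ℙ K (StarVec F K)

/-! ### The plane over `K`: sublines and their position with respect to the line at infinity -/

/-- `m` is an `𝔽_{q^k}`-subline of `PG(2, q^n)`: the points whose coordinates with respect to two
independent vectors `u, v` can be taken in the subfield of order `q^k`. -/
def IsSubline (k : ℕ) (m : Set (Plane K)) : Prop :=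
  ∃ (E : IntermediateField F K) (u v : K × K × K),
    Module.finrank F E = k ∧ LinearIndependent K ![u, v] ∧
      m = {P | ∃ s t : E, IsCoord P ((s : K) • u + (t : K) • v)}

variable {K} in
/-- `m` has no point on `l_∞`. -/
def IsExternal (m : Set (Plane K)) : Prop :=
  ∀ P ∈ m, ¬ P.submodule ≤ infinity K K

variable {K} in
/-- `m` has exactly one point on `l_∞`. -/
def IsTangent (m : Set (Plane K)) : Prop :=
  ∃! P, P ∈ m ∧ P.submodule ≤ infinity K K

/-- The smallest subline that contains `m` and is tangent to `l_∞` is an `𝔽_{q^r}`-subline. -/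
def SmallestTangentDegree (m : Set (Plane K)) (r : ℕ) : Prop :=
  (∃ m', IsSubline F K r m' ∧ IsTangent m' ∧ m ⊆ m') ∧
    ∀ (j : ℕ) (m' : Set (Plane K)), IsSubline F K j m' → IsTangent m' → m ⊆ m' → r ≤ j

/-! ### The André/Bruck-Bose representation -/

/-- The ABB-map `φ`, which sends `(a, b, 1)_K` to the point `(a, b, 1)_F` and `(a, b, 0)_K` to the
set of the points `(ax, bx, 0)_F`, `x ∈ K*`. -/
def abb (P : Plane K) : Set (Space F K) :=
  {Q | (∃ a b : K, IsCoord P (a, b, 1) ∧ IsCoord Q (a, b, 1)) ∨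
    ∃ a b x : K, IsCoord P (a, b, 0) ∧ x ≠ 0 ∧ IsCoord Q (a * x, b * x, 0)}

/-- The ABB-image of a set of points. -/
def abbImage (m : Set (Plane K)) : Set (Space F K) :=
  ⋃ P ∈ m, abb F K P

/-- `x ↦ (ax, bx, 0)`. -/
def spreadMap (a b : K) : K →ₗ[F] K × K × F :=
  (LinearMap.mulLeft F a).prod ((LinearMap.mulLeft F b).prod 0)

/-- The Desarguesian spread `D_k` of `H_∞`: its elements are the subspaces
`{(ax, bx, 0) | x ∈ 𝔽_{q^k}}` with `(a, b) ≠ (0, 0)`. -/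
def spread (k : ℕ) : Set (Submodule F (K × K × F)) :=
  {S | ∃ (E : IntermediateField F K) (a b : K), Module.finrank F E = k ∧ (a, b) ≠ (0, 0) ∧
    S = E.toSubalgebra.toSubmodule.map (spreadMap F K a b)}

/-! ### The embedding of `PG(2n, q)` in `PG(2n, q^n)` and the indicator set of `D_k` -/

/-- The embedding `ι` of `PG(2n, q)` in `PG(2n, q^n)`, on vectors:
`(a, b, c) ↦ (a, a^q, …, a^(q^(n-1)); b, b^q, …, b^(q^(n-1)); c)`. -/
def emb (v : K × K × F) : StarVec F K :=
  (fun i => v.1 ^ (Fintype.card F) ^ i.val, fun i => v.2.1 ^ (Fintype.card F) ^ i.val,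
    algebraMap F K v.2.2)

/-- The collineation `σ` of `PG(2n, q^n)`, on vectors:
`(a_0, …, a_{n-1}; b_0, …, b_{n-1}; c) ↦ (a_{n-1}^q, a_0^q, …; b_{n-1}^q, b_0^q, …; c^q)`. -/
def sigmaVec : StarVec F K →ₛₗ[(FiniteField.frobeniusAlgHom F K : K →+* K)] StarVec F K where
  toFun v := (fun i => v.1 (i - 1) ^ Fintype.card F, fun i => v.2.1 (i - 1) ^ Fintype.card F,
    v.2.2 ^ Fintype.card F)
  map_add' v w := by
    have h : ∀ x y : K, (x + y) ^ Fintype.card F = x ^ Fintype.card F + y ^ Fintype.card F :=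
      fun x y => map_add (FiniteField.frobeniusAlgHom F K) x y
    ext <;> simp [h]
  map_smul' c v := by
    ext <;> simp [mul_pow]

theorem sigmaVec_injective : Function.Injective (sigmaVec F K) := by
  have h : ∀ x y : K, x ^ Fintype.card F = y ^ Fintype.card F → x = y :=
    fun x y hxy => (FiniteField.frobeniusAlgHom F K).toRingHom.injective hxy
  rintro ⟨a, b, c⟩ ⟨a', b', c'⟩ hv
  simp only [sigmaVec, LinearMap.coe_mk, AddHom.coe_mk, Prod.mk.injEq] at hv
  obtain ⟨ha, hb, hc⟩ := hv
  refine Prod.ext (funext fun i => ?_) (Prod.ext (funext fun i => ?_) (h _ _ hc))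
  · simpa using h _ _ (congrFun ha (i + 1))
  · simpa using h _ _ (congrFun hb (i + 1))

/-- The collineation `σ` on points. -/
def sigma : StarSpace F K → StarSpace F K :=
  Projectivization.map (sigmaVec F K) (sigmaVec_injective F K)

/-- The points of the line `ν`, spanned by `(1, 0, …, 0; 0, …, 0; 0)` and
`(0, …, 0; 1, 0, …, 0; 0)`. -/
def nu : Set (StarSpace F K) :=
  {P | ∃ a b : K, IsCoord P (Pi.single 0 a, Pi.single 0 b, 0)}

/-- The subgeometry `Π = ⟨ν, ν^(σ^k), …, ν^(σ^(n-k))⟩ ∩ Fix(σ^k)`. -/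
def directorSpace (k : ℕ) : Set (StarSpace F K) :=
  {P | P.submodule ≤ spanPts (⋃ j ∈ Set.Iio (Module.finrank F K / k), (sigma F K)^[k * j] '' nu F K)
    ∧ (sigma F K)^[k] P = P}

/-- The points on the members of the indicator set `{Π, Π^σ, …, Π^(σ^(k-1))}` of `D_k`. -/
def indicatorPoints (k : ℕ) : Set (StarSpace F K) :=
  ⋃ i ∈ Set.Iio k, (sigma F K)^[i] '' directorSpace F K k

/-- The set `S` of points of `PG(2n, q^n)` meets the indicator set of `D_k` in `k` (distinct)
conjugate points `Q, Q^σ, …, Q^(σ^(k-1))`. -/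
def MeetsIndicator (k : ℕ) (S : Set (StarSpace F K)) : Prop :=
  ∃ Q : StarSpace F K, Set.InjOn (fun i : ℕ => (sigma F K)^[i] Q) (Set.Iio k) ∧
    S ∩ indicatorPoints F K k = (fun i : ℕ => (sigma F K)^[i] Q) '' Set.Iio k

/-- `C` is a normal rational curve of degree `r` in `PG(2n, q)` whose extension to `PG(2n, q^n)`
meets the indicator set of `D_r` in `r` conjugate points.  The extension of a curve is obtained by
letting the parameters of the curve range over `K` instead of `F`. -/
def IsSpecialCurve (r : ℕ) (C : Set (Space F K)) : Prop :=
  ∃ e : Fin (r + 1) → K × K × F, LinearIndependent F e ∧ C = ratCurve e ∧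
    MeetsIndicator F K r (ratCurve (fun i => emb F K (e i)))

/-- `M` spans an `r`-space that meets `H_∞` in an element of `D_r`. -/
def SpansOverSpread (r : ℕ) (M : Set (Space F K)) : Prop :=
  Module.finrank F (spanPts M) = r + 1 ∧ spanPts M ⊓ infinity F K ∈ spread F K r

/-- Every three points of `M` determine a normal rational curve of degree `r` whose extension
meets the indicator set of `D_r` in `r` conjugate points, and all points of this curve lie
in `M`. -/
def CurveClosed (r : ℕ) (M : Set (Space F K)) : Prop :=
  ∀ A ∈ M, ∀ B ∈ M, ∀ D ∈ M, A ≠ B → A ≠ D → B ≠ D →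
    ∃ C, (IsSpecialCurve F K r C ∧ {A, B, D} ⊆ C) ∧ C ⊆ M ∧
      ∀ C', IsSpecialCurve F K r C' ∧ {A, B, D} ⊆ C' → C' = C

end ABB

end

noncomputable section

namespace ABB

/-! ### Homogeneous coordinates and affine points -/

section Affine

variable {R : Type*} [Field R] {V : Type*} [AddCommGroup V] [Module R V]

/-! An affine point of the plane and its ABB-image are given by the same pair in `K × K`, so
sublines and curves can be compared as subsets of `K × K`. An external subline over `E` is `{a +
w/(c + θ) : c ∈ E ∪ {∞}}` with `θ ∉ E` (`lineSet`), and a change of frame acts on `θ` by a Möbius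
map over `E`. As `n` is a prime power, the subfields form a chain, so `E ≤ F(θ)`; the smallest
tangent subline is then the one over `F(θ)`, and `r = [F(θ) : F]`. Condition (i) follows by partial
fractions: since `r ≤ q`, the elements `1/(c + θ)` with `c ∈ F` span `F(θ)`.

For (ii), let `f` be the minimal polynomial of `η = -θ` and `g = f/(X - η)`. The vector `f(c)(a, 1)
+ g(c)(w, 0)` represents `a + w/(c - η)`, so a subline over `F` is a rational curve of degree `r`.
Its extension reaches infinity exactly at the conjugates of `η`; at `η` itself the `j`-th conjugate
of `g` vanishes unless `r ∣ j`, which places that point in the director space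
(`isSpecialCurve_lineSet`). Conversely, the position of `Q` forces the last coordinate of a special
curve to be a multiple of `f`, and the others to be combinations of `f` and `g`
(`IsSpecialCurve.exists_lineSet`). Uniqueness holds because three points determine a subline over a
given field.

In the reverse direction `M` is closed under `F`-sublines through three of its points. Hence `M` is
a `lineSet` over a parameter set `S` containing `0` and `1`, such that `S` and the set of its
negative inverses are closed under affine `F`-lines. For `q > 2` both are additive groups, and Hua's
identity makes `S` a field (`exists_intermediateField`), whose degree is read off from the size of
`M`. -/

theorem IsCoord.ne_zero {P : ℙ R V} {v : V} (h : IsCoord P v) : v ≠ 0 := h.1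

theorem isCoord_mk {v : V} (h : v ≠ 0) : IsCoord (Projectivization.mk R v h) v := ⟨h, rfl⟩

theorem exists_isCoord (P : ℙ R V) : ∃ v, IsCoord P v :=
  ⟨P.rep, P.rep_nonzero, P.mk_rep.symm⟩

theorem IsCoord.submodule_eq {P : ℙ R V} {v : V} (h : IsCoord P v) :
    P.submodule = Submodule.span R {v} := by
  obtain ⟨h, rfl⟩ := h
  rfl

theorem IsCoord.mem {P : ℙ R V} {v : V} (h : IsCoord P v) : v ∈ P.submodule := by
  rw [h.submodule_eq]
  exact Submodule.mem_span_singleton_self v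

theorem IsCoord.unique {P Q : ℙ R V} {v : V} (h : IsCoord P v) (h' : IsCoord Q v) : P = Q := by
  obtain ⟨_, rfl⟩ := h
  obtain ⟨_, rfl⟩ := h'
  rfl

theorem IsCoord.exists_smul {P : ℙ R V} {v w : V} (h : IsCoord P v) (h' : IsCoord P w) :
    ∃ c : R, c ≠ 0 ∧ w = c • v := by
  obtain ⟨hv, rfl⟩ := h
  obtain ⟨hw, e⟩ := h'
  obtain ⟨a, ha⟩ := (Projectivization.mk_eq_mk_iff R _ _ hw hv).1 e.symm
  exact ⟨a, a.ne_zero, ha.symm⟩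

theorem IsCoord.smul {P : ℙ R V} {v : V} (h : IsCoord P v) {c : R} (hc : c ≠ 0) :
    IsCoord P (c • v) := by
  obtain ⟨hv, rfl⟩ := h
  refine ⟨smul_ne_zero hc hv, ?_⟩
  rw [Projectivization.mk_eq_mk_iff']
  exact ⟨c⁻¹, by rw [smul_smul, inv_mul_cancel₀ hc, one_smul]⟩

theorem isCoord_smul_iff {P : ℙ R V} {v : V} {c : R} (hc : c ≠ 0) :
    IsCoord P (c • v) ↔ IsCoord P v := by
  refine ⟨fun h => ?_, fun h => h.smul hc⟩
  simpa [smul_smul, inv_mul_cancel₀ hc] using h.smul (inv_ne_zero hc)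

variable {A : Type*} [AddCommGroup A]

theorem affine_ne_zero (p : A × A) : ((p.1, p.2, (1 : R)) : A × A × R) ≠ 0 := fun h => by
  simpa using congrArg (fun v => v.2.2) h

variable [Module R A]

variable (R) in
/-- The affine points `(x, y, 1)_R` with `(x, y) ∈ T`. -/
def affineSet (T : Set (A × A)) : Set (ℙ R (A × A × R)) :=
  {P | ∃ p ∈ T, IsCoord P (p.1, p.2, (1 : R))}

variable (R) in
/-- The affine point `(x, y, 1)_R`. -/
def affinePt (p : A × A) : ℙ R (A × A × R) := Projectivization.mk R _ (affine_ne_zero p)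

theorem isCoord_affinePt (p : A × A) : IsCoord (affinePt R p) (p.1, p.2, (1 : R)) :=
  isCoord_mk _

theorem affinePt_injective : Function.Injective (affinePt R : A × A → ℙ R (A × A × R)) := by
  intro p p' h
  obtain ⟨c, -, h⟩ := (isCoord_affinePt (R := R) p).exists_smul (h ▸ isCoord_affinePt p')
  simp only [Prod.smul_mk, smul_eq_mul, mul_one, Prod.mk.injEq] at h
  obtain ⟨h1, h2, rfl⟩ := h
  exact Prod.ext (by simpa using h1.symm) (by simpa using h2.symm)

theorem isCoord_affine_iff {P : ℙ R (A × A × R)} {p : A × A} :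
    IsCoord P (p.1, p.2, (1 : R)) ↔ P = affinePt R p :=
  ⟨fun h => h.unique (isCoord_affinePt p), fun h => h ▸ isCoord_affinePt p⟩

theorem affineSet_eq_image (T : Set (A × A)) : affineSet R T = affinePt R '' T := by
  ext P
  simp only [affineSet, Set.mem_ofPred_eq, isCoord_affine_iff, Set.mem_image, eq_comm]

@[simp]
theorem affinePt_mem_affineSet {T : Set (A × A)} {p : A × A} :
    affinePt R p ∈ affineSet R T ↔ p ∈ T := by
  rw [affineSet_eq_image, affinePt_injective.mem_set_image]

theorem affineSet_subset {T T' : Set (A × A)} : affineSet R T ⊆ affineSet R T' ↔ T ⊆ T' := by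
  rw [affineSet_eq_image, affineSet_eq_image, Set.image_subset_image_iff affinePt_injective]

theorem IsCoord.le_infinity {P : ℙ R (A × A × R)} {v : A × A × R} (h : IsCoord P v) :
    P.submodule ≤ infinity R A ↔ v.2.2 = 0 := by
  rw [h.submodule_eq, Submodule.span_singleton_le_iff_mem]
  simp [infinity]

theorem affinePt_not_le (p : A × A) : ¬ (affinePt R p).submodule ≤ infinity R A := by
  rw [(isCoord_affinePt p).le_infinity]
  exact one_ne_zero

theorem IsCoord.eq_affinePt {P : ℙ R (A × A × R)} {v : A × A × R} (h : IsCoord P v)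
    (hv : v.2.2 ≠ 0) : P = affinePt R (v.2.2⁻¹ • (v.1, v.2.1)) := by
  rw [← isCoord_affine_iff]
  have := h.smul (inv_ne_zero hv)
  convert this using 1
  ext <;> simp [hv]

theorem exists_affinePt {P : ℙ R (A × A × R)} (h : ¬ P.submodule ≤ infinity R A) :
    ∃ p, P = affinePt R p := by
  obtain ⟨v, hv⟩ := exists_isCoord P
  rw [hv.le_infinity] at h
  exact ⟨_, hv.eq_affinePt h⟩

theorem exists_affineSet {S : Set (ℙ R (A × A × R))} (h : ∀ P ∈ S, ¬ P.submodule ≤ infinity R A) :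
    ∃ T, S = affineSet R T := by
  refine ⟨affinePt R ⁻¹' S, ?_⟩
  rw [affineSet_eq_image, Set.image_preimage_eq_of_subset]
  intro P hP
  obtain ⟨p, rfl⟩ := exists_affinePt (h P hP)
  exact ⟨p, rfl⟩

theorem not_le_of_mem_affineSet {T : Set (A × A)} {P : ℙ R (A × A × R)} (h : P ∈ affineSet R T) :
    ¬ P.submodule ≤ infinity R A := by
  rw [affineSet_eq_image] at h
  obtain ⟨p, -, rfl⟩ := h
  exact affinePt_not_le p

theorem ncard_affineSet (T : Set (A × A)) : (affineSet R T).ncard = T.ncard := by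
  rw [affineSet_eq_image, Set.ncard_image_of_injective _ affinePt_injective]

end Affine

variable (F K : Type*) [Field F] [Field K] [Algebra F K]

theorem abbImage_affineSet (T : Set (K × K)) :
    abbImage F K (affineSet K T) = affineSet F T := by
  ext Q
  simp only [abbImage, Set.mem_iUnion, exists_prop]
  constructor
  · rintro ⟨P, hP, h | ⟨a, b, x, hab, -, -⟩⟩
    · obtain ⟨a, b, hab, h⟩ := h
      rw [isCoord_affine_iff (p := (a, b))] at hab h
      subst hab h
      simpa using hP
    · exact absurd (hab.le_infinity.2 rfl) (not_le_of_mem_affineSet hP)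
  · rintro ⟨p, hp, h⟩
    exact ⟨affinePt K p, by simpa using hp, Or.inl ⟨p.1, p.2, isCoord_affinePt p, h⟩⟩

/-- The affine points `a + w / (c + θ)`, `c ∈ S`, on the line through `a` with direction `w`,
together with the point `a` itself. -/
def lineSet {K : Type*} [Field K] (S : Set K) (a w : K × K) (θ : K) : Set (K × K) :=
  insert a ((fun c => a + (c + θ)⁻¹ • w) '' S)

end ABB

namespace ABB

/-! ### Möbius changes of parameter on a subline -/

section LineSet

variable {K : Type*} [Field K]

theorem base_mem_lineSet {S : Set K} {a w : K × K} {θ : K} : a ∈ lineSet S a w θ :=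
  Set.mem_insert _ _

theorem mem_lineSet {S : Set K} {a w : K × K} {θ c : K} (h : c ∈ S) :
    a + (c + θ)⁻¹ • w ∈ lineSet S a w θ :=
  Set.mem_insert_of_mem _ ⟨c, h, rfl⟩

theorem lineSet_mono {S S' : Set K} (h : S ⊆ S') (a w : K × K) (θ : K) :
    lineSet S a w θ ⊆ lineSet S' a w θ :=
  Set.insert_subset_insert (Set.image_mono h)

/-- Moving the base point of a `lineSet` to the point with parameter `c₀`. -/
theorem lineSet_rebase {S : Set K} (a w : K × K) {θ c₀ : K} (hS : ∀ d ∈ S, d + θ ≠ 0)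
    (h₀ : c₀ ∈ S) :
    lineSet S a w θ = lineSet ((fun d => (c₀ - d)⁻¹) '' S) (a + (c₀ + θ)⁻¹ • w)
      (((c₀ + θ) ^ 2)⁻¹ • w) (-(c₀ + θ)⁻¹) := by
  have h0 := hS c₀ h₀
  have key : ∀ d ∈ S, d ≠ c₀ → a + (c₀ + θ)⁻¹ • w +
      ((c₀ - d)⁻¹ + -(c₀ + θ)⁻¹)⁻¹ • (((c₀ + θ) ^ 2)⁻¹ • w) = a + (d + θ)⁻¹ • w := by
    intro d hd hdc
    have h1 := hS d hd
    have h2 : c₀ - d ≠ 0 := sub_ne_zero.2 (Ne.symm hdc)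
    have h3 : (c₀ - d)⁻¹ + -(c₀ + θ)⁻¹ = (d + θ) * ((c₀ - d) * (c₀ + θ))⁻¹ := by
      field_simp
      ring
    rw [h3, smul_smul, add_assoc, ← add_smul]
    congr 2
    field_simp
    ring
  -- The parameter `∞` of the old base point should become `1/(c₀ - ∞) = 0`. The convention `0⁻¹ =
  -- 0` supplies exactly this parameter, as the image of `c₀`, while the point `c₀` becomes the new
  -- base.
  have key0 : a + (c₀ + θ)⁻¹ • w +
      ((c₀ - c₀)⁻¹ + -(c₀ + θ)⁻¹)⁻¹ • (((c₀ + θ) ^ 2)⁻¹ • w) = a := by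
    rw [smul_smul, add_assoc, ← add_smul]
    convert add_zero a
    rw [sub_self, inv_zero, zero_add]
    convert zero_smul K w
    field_simp
    ring
  apply Set.Subset.antisymm
  · rintro p (rfl | ⟨d, hd, rfl⟩)
    · refine Set.mem_insert_of_mem _ ⟨_, ⟨c₀, h₀, rfl⟩, key0⟩
    · by_cases hdc : d = c₀
      · subst hdc
        exact base_mem_lineSet
      · exact Set.mem_insert_of_mem _ ⟨_, ⟨d, hd, rfl⟩, key d hd hdc⟩
  · rintro p (rfl | ⟨_, ⟨d, hd, rfl⟩, rfl⟩)
    · exact mem_lineSet h₀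
    · by_cases hdc : d = c₀
      · subst hdc
        simp only [key0]
        exact base_mem_lineSet
      · simp only [key d hd hdc]
        exact mem_lineSet hd

theorem lineSet_rescale (S : Set K) (a w : K × K) (θ c₀ : K) {μ : K} (hμ : μ ≠ 0) :
    lineSet S a w θ = lineSet ((fun d => (d - c₀) / μ) '' S) a (μ⁻¹ • w) ((c₀ + θ) / μ) := by
  rw [lineSet, lineSet, Set.image_image]
  congr 2
  ext1 d
  rw [smul_smul]
  congr 2
  rw [← add_div, show d - c₀ + (c₀ + θ) = d + θ by ring, inv_div]
  field_simp

theorem lineSet_inj {a w : K × K} {θ c d : K} (hw : w ≠ 0)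
    (h : a + (c + θ)⁻¹ • w = a + (d + θ)⁻¹ • w) : c = d := by
  have := smul_left_injective K hw (add_left_cancel h)
  exact add_right_cancel (inv_injective this)

variable {F : Type*} [Field F] [Algebra F K] {E : IntermediateField F K}

theorem add_ne_zero_of_notMem {θ : K} (hθ : θ ∉ E) {c : K} (hc : c ∈ E) : c + θ ≠ 0 := fun h =>
  hθ (by rw [← neg_eq_of_add_eq_zero_right h]; exact E.neg_mem hc)

/-- The map `x ↦ 1/(c - x)` has coefficients in `E`, so it permutes `E ∪ {∞}` and does not affect
which overfields of `E` contain the parameter. -/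
theorem exists_lineSet_base {a w p : K × K} {θ : K} (hw : w ≠ 0) (hθ : θ ∉ E)
    (hp : p ∈ lineSet (E : Set K) a w θ) :
    ∃ w' θ', lineSet (E : Set K) a w θ = lineSet E p w' θ' ∧ w' ≠ 0 ∧
      ∀ E' : IntermediateField F K, E ≤ E' → (θ ∈ E' ↔ θ' ∈ E') := by
  obtain rfl | ⟨c, hc, rfl⟩ := hp
  · exact ⟨w, θ, rfl, hw, fun _ _ => Iff.rfl⟩
  · have hne := add_ne_zero_of_notMem hθ hc
    refine ⟨((c + θ) ^ 2)⁻¹ • w, -(c + θ)⁻¹, (lineSet_rebase a w (fun d => add_ne_zero_of_notMem hθ) hc).trans ?_,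
      smul_ne_zero (inv_ne_zero (pow_ne_zero 2 hne)) hw, fun E' hE => ?_⟩
    · congr 1
      ext x
      constructor
      · rintro ⟨d, hd, rfl⟩
        exact E.inv_mem (E.sub_mem hc hd)
      · intro hx
        exact ⟨c - x⁻¹, E.sub_mem hc (E.inv_mem hx), by simp⟩
    · rw [neg_mem_iff, inv_mem_iff]
      exact (add_mem_cancel_left (hE hc)).symm

/-- Three distinct points of a subline can be put in normal position. -/
theorem exists_lineSet_normal {a w p₁ p₂ p₃ : K × K} {θ : K} (hw : w ≠ 0) (hθ : θ ∉ E)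
    (h₁ : p₁ ∈ lineSet (E : Set K) a w θ) (h₂ : p₂ ∈ lineSet (E : Set K) a w θ)
    (h₃ : p₃ ∈ lineSet (E : Set K) a w θ) (h₁₂ : p₁ ≠ p₂) (h₁₃ : p₁ ≠ p₃) (h₂₃ : p₂ ≠ p₃) :
    ∃ w' θ', lineSet (E : Set K) a w θ = lineSet E p₁ w' θ' ∧ w' ≠ 0 ∧
      (∀ E' : IntermediateField F K, E ≤ E' → (θ ∈ E' ↔ θ' ∈ E')) ∧
      p₂ = p₁ + θ'⁻¹ • w' ∧ p₃ = p₁ + (1 + θ')⁻¹ • w' := by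
  obtain ⟨w₁, θ₁, h, hw₁, hE⟩ := exists_lineSet_base hw hθ h₁
  rw [h] at h₂ h₃
  obtain h₂ | ⟨c, hc, rfl⟩ := h₂
  · exact absurd h₂.symm h₁₂
  obtain h₃ | ⟨d, hd, rfl⟩ := h₃
  · exact absurd h₃.symm h₁₃
  have hdc : d - c ≠ 0 := fun h0 => h₂₃ (by rw [sub_eq_zero.1 h0])
  -- With `p₁` at `∞`, the affine map `x ↦ (x - c)/(d - c)` moves the parameters `c`, `d` of `p₂`,
  -- `p₃` to `0`, `1`.
  refine ⟨(d - c)⁻¹ • w₁, (c + θ₁) / (d - c), h.trans ((lineSet_rescale (E : Set K) p₁ w₁ θ₁ c hdc).trans ?_),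
    smul_ne_zero (inv_ne_zero hdc) hw₁, fun E' hE' => (hE E' hE').trans ?_, ?_, ?_⟩
  · congr 1
    ext x
    constructor
    · rintro ⟨y, hy, rfl⟩
      exact E.div_mem (E.sub_mem hy hc) (E.sub_mem hd hc)
    · intro hx
      refine ⟨x * (d - c) + c, E.add_mem (E.mul_mem hx (E.sub_mem hd hc)) hc, ?_⟩
      simp [hdc]
  · have hd' := E'.sub_mem (hE' hd) (hE' hc)
    constructor
    · intro h
      exact E'.div_mem (E'.add_mem (hE' hc) h) hd'
    · intro h
      have := E'.sub_mem (E'.mul_mem h hd') (hE' hc)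
      simpa [hdc] using this
  · rw [smul_smul]
    field_simp
  · rw [smul_smul]
    have : 1 + (c + θ₁) / (d - c) = (d + θ₁) / (d - c) := by
      field_simp
      ring
    rw [this, inv_div]
    field_simp

/-- The ratio of `v` to `u` is `θ/(1 + θ)`, an injective function of `θ`. -/
theorem lineSet_normal_unique {u v w w' : K × K} {θ θ' : K} (hw : w ≠ 0)
    (h0 : θ ≠ 0) (h1 : 1 + θ ≠ 0) (h0' : θ' ≠ 0) (h1' : 1 + θ' ≠ 0)
    (hu : u = θ⁻¹ • w) (hv : v = (1 + θ)⁻¹ • w)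
    (hu' : u = θ'⁻¹ • w') (hv' : v = (1 + θ')⁻¹ • w') : θ = θ' ∧ w = w' := by
  have e : w = θ • u := by rw [hu, smul_smul, mul_inv_cancel₀ h0, one_smul]
  have e' : w' = θ' • u := by rw [hu', smul_smul, mul_inv_cancel₀ h0', one_smul]
  have hu0 : u ≠ 0 := by
    rintro rfl
    simp [hw] at e
  have hθ : θ = θ' := by
    rw [hv, e, e', smul_smul, smul_smul] at hv'
    have := smul_left_injective K hu0 hv'
    field_simp at this
    linear_combination this
  exact ⟨hθ, by rw [e, e', hθ]⟩

/-- Sublines over the same field with three common points are equal. -/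
theorem lineSet_eq_of_common {a w a' w' p₁ p₂ p₃ : K × K} {θ θ' : K} (hw : w ≠ 0) (hw' : w' ≠ 0)
    (hθ : θ ∉ E) (hθ' : θ' ∉ E)
    (h₁ : p₁ ∈ lineSet (E : Set K) a w θ) (h₂ : p₂ ∈ lineSet (E : Set K) a w θ)
    (h₃ : p₃ ∈ lineSet (E : Set K) a w θ)
    (h₁' : p₁ ∈ lineSet (E : Set K) a' w' θ') (h₂' : p₂ ∈ lineSet (E : Set K) a' w' θ')
    (h₃' : p₃ ∈ lineSet (E : Set K) a' w' θ') (h₁₂ : p₁ ≠ p₂) (h₁₃ : p₁ ≠ p₃) (h₂₃ : p₂ ≠ p₃) :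
    lineSet (E : Set K) a w θ = lineSet E a' w' θ' := by
  obtain ⟨w₁, θ₁, e, hw₁, hE, hu, hv⟩ := exists_lineSet_normal hw hθ h₁ h₂ h₃ h₁₂ h₁₃ h₂₃
  obtain ⟨w₂, θ₂, e', hw₂, hE', hu', hv'⟩ :=
    exists_lineSet_normal hw' hθ' h₁' h₂' h₃' h₁₂ h₁₃ h₂₃
  have hθ₁ := (hE E le_rfl).not.1 hθ
  have hθ₂ := (hE' E le_rfl).not.1 hθ'
  have n0 : ∀ {x : K}, x ∉ E → x ≠ 0 := fun hx h => hx (h ▸ E.zero_mem)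
  obtain ⟨rfl, rfl⟩ := lineSet_normal_unique (w' := w₂) (u := p₂ - p₁) (v := p₃ - p₁) hw₁ (n0 hθ₁)
    (add_ne_zero_of_notMem hθ₁ E.one_mem) (n0 hθ₂) (add_ne_zero_of_notMem hθ₂ E.one_mem)
    (by rw [hu]; simp) (by rw [hv]; simp) (by rw [hu']; simp) (by rw [hv']; simp)
  rw [e, e']

end LineSet

/-! ### The chain of subfields -/

section Subfields

open IntermediateField

variable {F K : Type*} [Field F] [Field K] [Finite K] [Algebra F K]

/-- Divisibility of degrees gives an embedding of `E` into `E'`; by normality its image inside `K`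
is `E` itself. -/
theorem le_of_finrank_dvd {E E' : IntermediateField F K}
    (h : Module.finrank F E ∣ Module.finrank F E') : E ≤ E' := by
  obtain ⟨f⟩ := FiniteField.nonempty_algHom_of_finrank_dvd h
  have := (E'.val.comp f).fieldRange_of_normal
  rw [← this]
  rintro _ ⟨x, rfl⟩
  exact (f x).2

theorem le_total_of_isPrimePow (hn : IsPrimePow (Module.finrank F K))
    (E E' : IntermediateField F K) : E ≤ E' ∨ E' ≤ E := by
  obtain ⟨p, e, hp, -, he⟩ := hn
  have hd : ∀ L : IntermediateField F K, Module.finrank F L ∣ p ^ e := fun L => by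
    rw [he, ← Module.finrank_mul_finrank F L K]
    exact dvd_mul_right _ _
  obtain ⟨i, -, hi⟩ := (Nat.dvd_prime_pow hp.nat_prime).1 (hd E)
  obtain ⟨j, -, hj⟩ := (Nat.dvd_prime_pow hp.nat_prime).1 (hd E')
  rcases le_total i j with h | h
  · exact Or.inl (le_of_finrank_dvd (by rw [hi, hj]; exact pow_dvd_pow p h))
  · exact Or.inr (le_of_finrank_dvd (by rw [hi, hj]; exact pow_dvd_pow p h))

theorem le_adjoin_of_notMem (hn : IsPrimePow (Module.finrank F K))
    {E : IntermediateField F K} {θ : K} (hθ : θ ∉ E) : E ≤ F⟮θ⟯ :=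
  (le_total_of_isPrimePow hn E F⟮θ⟯).resolve_right fun h =>
    hθ (h (mem_adjoin_simple_self F θ))

/-- By the chain property `F(θ)` and `F(θ')` both contain `E`, so they are themselves among the
overfields tested by the hypothesis. -/
theorem adjoin_eq_of_mobius (hn : IsPrimePow (Module.finrank F K))
    {E : IntermediateField F K} {θ θ' : K} (hθ : θ ∉ E)
    (h : ∀ E' : IntermediateField F K, E ≤ E' → (θ ∈ E' ↔ θ' ∈ E')) : F⟮θ⟯ = F⟮θ'⟯ := by
  have hθ' := (h E le_rfl).not.1 hθ
  apply le_antisymm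
  · rw [adjoin_simple_le_iff, h _ (le_adjoin_of_notMem hn hθ')]
    exact mem_adjoin_simple_self F θ'
  · rw [adjoin_simple_le_iff, ← h _ (le_adjoin_of_notMem hn hθ)]
    exact mem_adjoin_simple_self F θ

end Subfields

end ABB

/-! ### External and tangent sublines of the plane -/

namespace ABB

variable {F K : Type*} [Field F] [Field K] [Algebra F K]

theorem mem_subline_iff {E : IntermediateField F K} {u v : K × K × K} {P : Plane K} :
    (∃ s t : E, IsCoord P ((s : K) • u + (t : K) • v)) ↔
      IsCoord P u ∨ ∃ c ∈ E, IsCoord P (c • u + v) := by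
  constructor
  · rintro ⟨s, t, h⟩
    by_cases ht : (t : K) = 0
    · rw [ht, zero_smul, add_zero] at h
      have hs : (s : K) ≠ 0 := by
        intro hs
        exact h.ne_zero (by rw [hs, zero_smul])
      exact Or.inl ((isCoord_smul_iff hs).1 h)
    · refine Or.inr ⟨s / t, E.div_mem s.2 t.2, ?_⟩
      rw [← isCoord_smul_iff ht, smul_add, smul_smul, mul_div_cancel₀ _ ht]
      exact h
  · rintro (h | ⟨c, hc, h⟩)
    · exact ⟨1, 0, by simpa using h⟩
    · exact ⟨⟨c, hc⟩, 1, by simpa using h⟩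

theorem isSubline_lineSet {E : IntermediateField F K} {a w : K × K} {θ : K} (hw : w ≠ 0)
    (hθ : θ ∉ E) : IsSubline F K (Module.finrank F E) (affineSet K (lineSet (E : Set K) a w θ)) := by
  -- The second vector is `θ(a, 1) + (w, 0)`, so that `c • u + v = (c + θ)(a + w/(c + θ), 1)`.
  refine ⟨E, (a.1, a.2, 1), (θ * a.1 + w.1, θ * a.2 + w.2, θ), rfl, ?_, ?_⟩
  · rw [LinearIndependent.pair_iff]
    intro s t h
    simp only [Prod.smul_mk, smul_eq_mul, Prod.mk_add_mk, Prod.mk_eq_zero] at h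
    obtain ⟨h1, h2, h3⟩ := h
    have e1 : t * w.1 = 0 := by linear_combination h1 - a.1 * h3
    have e2 : t * w.2 = 0 := by linear_combination h2 - a.2 * h3
    have ht : t = 0 := by
      by_contra ht
      exact hw (Prod.ext ((mul_eq_zero.1 e1).resolve_left ht)
        ((mul_eq_zero.1 e2).resolve_left ht))
    subst ht
    simpa using h3
  · ext P
    rw [Set.mem_ofPred_eq, mem_subline_iff, isCoord_affine_iff, affineSet_eq_image]
    have key : ∀ c ∈ E, IsCoord P (c • ((a.1, a.2, 1) : K × K × K) +
        (θ * a.1 + w.1, θ * a.2 + w.2, θ)) ↔ P = affinePt K (a + (c + θ)⁻¹ • w) := by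
      intro c hc
      have hne := add_ne_zero_of_notMem hθ hc
      rw [← isCoord_affine_iff, ← isCoord_smul_iff hne (P := P)
        (v := ((a + (c + θ)⁻¹ • w).1, (a + (c + θ)⁻¹ • w).2, (1 : K)))]
      congr! 1
      ext <;> simp <;> field_simp <;> ring
    constructor
    · rintro ⟨p, rfl | ⟨c, hc, rfl⟩, rfl⟩
      · exact Or.inl rfl
      · exact Or.inr ⟨c, hc, (key c hc).2 rfl⟩
    · rintro (rfl | ⟨c, hc, h⟩)
      · exact ⟨a, base_mem_lineSet, rfl⟩
      · exact ⟨_, mem_lineSet hc, ((key c hc).1 h).symm⟩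

theorem isExternal_affineSet (T : Set (K × K)) : IsExternal (affineSet K T) := fun _ hP =>
  not_le_of_mem_affineSet hP

/-- Every external subline is a `lineSet`. -/
theorem exists_eq_lineSet {k : ℕ} {m : Set (Plane K)} (hm : IsSubline F K k m)
    (hext : IsExternal m) : ∃ (E : IntermediateField F K) (a w : K × K) (θ : K),
      Module.finrank F E = k ∧ w ≠ 0 ∧ θ ∉ E ∧ m = affineSet K (lineSet (E : Set K) a w θ) := by
  obtain ⟨E, u, v, hk, hli, rfl⟩ := hm
  rw [LinearIndependent.pair_iff] at hli
  have hu : u ≠ 0 := by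
    rintro rfl
    simpa using hli 1 0 (by simp)
  have hcv : ∀ c : K, c • u + v ≠ 0 := by
    intro c h
    simpa using hli c 1 (by simpa using h)
  have hu3 : u.2.2 ≠ 0 := fun h => hext (Projectivization.mk K u hu)
    (mem_subline_iff.2 (Or.inl (isCoord_mk hu))) ((isCoord_mk hu).le_infinity.2 h)
  have hv3 : ∀ c ∈ E, c * u.2.2 + v.2.2 ≠ 0 := fun c hc h =>
    hext (Projectivization.mk K _ (hcv c))
      (mem_subline_iff.2 (Or.inr ⟨c, hc, isCoord_mk (hcv c)⟩))
      ((isCoord_mk (hcv c)).le_infinity.2 (by simpa using h))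
  -- Chosen so that `c • u + v` is `u₃(c + θ)` times `(a + w/(c + θ), 1)`. The third coordinate
  -- never vanishes for `c ∈ E`, which says `θ ∉ E`.
  set θ := v.2.2 / u.2.2 with hθdef
  set a : K × K := u.2.2⁻¹ • (u.1, u.2.1) with hadef
  set w : K × K := u.2.2⁻¹ • (v.1, v.2.1) - θ • a with hwdef
  have hw : w ≠ 0 := by
    intro h
    have h1 := congrArg Prod.fst h
    have h2 := congrArg Prod.snd h
    simp only [hwdef, hadef, hθdef, Prod.fst_sub, Prod.snd_sub, Prod.smul_fst, Prod.smul_snd,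
      smul_eq_mul, Prod.fst_zero, Prod.snd_zero] at h1 h2
    field_simp at h1 h2
    refine one_ne_zero (hli (-(v.2.2 / u.2.2)) 1 ?_).2
    ext <;> simp <;> field_simp
    · linear_combination h1
    · linear_combination h2
    · ring
  have hθ : θ ∉ E := by
    intro h
    refine hv3 (-θ) (E.neg_mem h) ?_
    rw [hθdef]
    field_simp
    ring
  refine ⟨E, a, w, θ, hk, hw, hθ, ?_⟩
  have key : ∀ c ∈ E, ∀ P : Plane K, IsCoord P (c • u + v) ↔
      P = affinePt K (a + (c + θ)⁻¹ • w) := by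
    intro c hc P
    have hne := add_ne_zero_of_notMem hθ hc
    rw [← isCoord_affine_iff, ← isCoord_smul_iff (mul_ne_zero hu3 hne) (P := P)
      (v := ((a + (c + θ)⁻¹ • w).1, (a + (c + θ)⁻¹ • w).2, (1 : K)))]
    congr! 1
    ext
    · simp only [hwdef, hadef, Prod.fst_add, Prod.fst_sub, Prod.smul_fst, smul_eq_mul]
      field_simp
      ring
    · simp only [hwdef, hadef, Prod.fst_add, Prod.snd_add, Prod.snd_sub, Prod.smul_fst,
        Prod.smul_snd, smul_eq_mul]
      field_simp
      ring
    · simp only [hθdef, Prod.snd_add, Prod.smul_snd, smul_eq_mul]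
      field_simp
  have keyu : ∀ P : Plane K, IsCoord P u ↔ P = affinePt K a := by
    intro P
    rw [← isCoord_affine_iff, ← isCoord_smul_iff hu3 (P := P) (v := (a.1, a.2, (1 : K)))]
    congr! 1
    ext <;> simp [hadef, hu3]
  ext P
  rw [Set.mem_ofPred_eq, mem_subline_iff, affineSet_eq_image, keyu]
  constructor
  · rintro (rfl | ⟨c, hc, h⟩)
    · exact ⟨a, base_mem_lineSet, rfl⟩
    · exact ⟨_, mem_lineSet hc, ((key c hc P).1 h).symm⟩
  · rintro ⟨p, rfl | ⟨c, hc, rfl⟩, rfl⟩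
    · exact Or.inl rfl
    · exact Or.inr ⟨c, hc, (key c hc _).2 rfl⟩

/-- The affine points of a tangent subline. -/
theorem IsTangent.exists_affine {E : IntermediateField F K} {u v : K × K × K}
    {m : Set (Plane K)} (hli : LinearIndependent K ![u, v])
    (hm : m = {P | ∃ s t : E, IsCoord P ((s : K) • u + (t : K) • v)}) (ht : IsTangent m) :
    ∃ x b : K × K, ∀ p, affinePt K p ∈ m → ∃ y ∈ E, p = x + y • b := by
  wlog hu : u.2.2 ≠ 0 generalizing u v with H
  · have hv : v.2.2 ≠ 0 := by
      intro hv
      rw [LinearIndependent.pair_iff] at hli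
      have hu0 : u ≠ 0 := by
        rintro rfl
        simpa using hli 1 0 (by simp)
      have hv0 : v ≠ 0 := by
        rintro rfl
        simpa using hli 0 1 (by simp)
      have := ht.unique (y₁ := Projectivization.mk K u hu0) (y₂ := Projectivization.mk K v hv0)
        ⟨hm ▸ ⟨1, 0, by simpa using isCoord_mk hu0⟩,
          (isCoord_mk hu0).le_infinity.2 (not_not.1 hu)⟩
        ⟨hm ▸ ⟨0, 1, by simpa using isCoord_mk hv0⟩, (isCoord_mk hv0).le_infinity.2 hv⟩
      obtain ⟨c, hc, e⟩ := (isCoord_mk (R := K) hu0).exists_smul (this ▸ isCoord_mk hv0)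
      simpa using hli (-c) 1 (by rw [e]; simp)
    refine H (u := v) (v := u) (LinearIndependent.pair_symm_iff.1 hli) ?_ hv
    rw [hm]
    ext P
    constructor
    · rintro ⟨s, t, h⟩
      exact ⟨t, s, by rwa [add_comm]⟩
    · rintro ⟨s, t, h⟩
      exact ⟨t, s, by rwa [add_comm]⟩
  subst hm
  obtain ⟨P, ⟨hP, hPinf⟩, -⟩ := ht
  obtain hP | ⟨c, hc, hP⟩ := mem_subline_iff.1 hP
  · exact absurd (hP.le_infinity.1 hPinf) hu
  have hv3 : v.2.2 = -(c * u.2.2) := by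
    have := hP.le_infinity.1 hPinf
    simp only [Prod.snd_add, Prod.smul_snd, smul_eq_mul] at this
    linear_combination this
  -- `b` is the direction of the point at infinity `c • u + v`. Writing `d • u + v = (d - c) • u +
  -- (c • u + v)` gives the affine parameter `1/(d - c)`.
  refine ⟨u.2.2⁻¹ • (u.1, u.2.1), u.2.2⁻¹ • (c * u.1 + v.1, c * u.2.1 + v.2.1), ?_⟩
  intro p hp
  obtain hp | ⟨d, hd, hp⟩ := mem_subline_iff.1 hp
  · refine ⟨0, E.zero_mem, ?_⟩
    rw [zero_smul, add_zero]
    exact affinePt_injective (hp.eq_affinePt hu)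
  · have h3 : (d • u + v).2.2 = (d - c) * u.2.2 := by
      simp only [Prod.snd_add, Prod.smul_snd, smul_eq_mul, hv3]
      ring
    have hdc : d - c ≠ 0 := by
      intro h
      refine affinePt_not_le (R := K) p (hp.le_infinity.2 ?_)
      rw [h3, h, zero_mul]
    refine ⟨(d - c)⁻¹, E.inv_mem (E.sub_mem hd hc), ?_⟩
    rw [affinePt_injective (hp.eq_affinePt (by rw [h3]; exact mul_ne_zero hdc hu)), h3]
    ext <;> simp <;> field_simp <;> ring

open IntermediateField

/-- The degree of the smallest tangent subline through an external subline. -/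
theorem smallestTangentDegree_lineSet_iff {E : IntermediateField F K} {a w : K × K} {θ : K}
    (hw : w ≠ 0) (hθ : θ ∉ E) (hE : E ≤ F⟮θ⟯) [FiniteDimensional F K] (r : ℕ) :
    SmallestTangentDegree F K (affineSet K (lineSet (E : Set K) a w θ)) r ↔
      Module.finrank F F⟮θ⟯ = r := by
  set m := affineSet K (lineSet (E : Set K) a w θ) with hm
  -- The points with parameters `∞`, `0`, `1` have positions `y₀`, `y₁`, `y₂` in `L` on the tangent
  -- subline; eliminating `w` expresses `θ` rationally in them.
  have lower : ∀ (j : ℕ) (m' : Set (Plane K)), IsSubline F K j m' → IsTangent m' → m ⊆ m' →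
      Module.finrank F F⟮θ⟯ ≤ j := by
    rintro j m' ⟨L, u, v, rfl, hli, h⟩ ht hsub
    obtain ⟨x, b, hx⟩ := ht.exists_affine hli h
    have hmem : ∀ p ∈ lineSet (E : Set K) a w θ, ∃ y ∈ L, p = x + y • b := fun p hp =>
      hx p (hsub (affinePt_mem_affineSet.2 hp))
    obtain ⟨y₀, hy₀, e₀⟩ := hmem _ base_mem_lineSet
    obtain ⟨y₁, hy₁, e₁⟩ := hmem _ (mem_lineSet E.zero_mem)
    obtain ⟨y₂, hy₂, e₂⟩ := hmem _ (mem_lineSet E.one_mem)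
    have hθ0 : θ ≠ 0 := fun h => hθ (h ▸ E.zero_mem)
    have hθ1 := add_ne_zero_of_notMem hθ E.one_mem
    rw [zero_add] at e₁
    have f₁ : w = (θ * (y₁ - y₀)) • b := by
      have : θ⁻¹ • w = (y₁ - y₀) • b := by
        rw [sub_smul, ← add_sub_add_left_eq_sub _ _ x, ← e₁, ← e₀, add_sub_cancel_left]
      rw [mul_smul, ← this, smul_smul, mul_inv_cancel₀ hθ0, one_smul]
    have f₂ : w = ((1 + θ) * (y₂ - y₀)) • b := by
      have : (1 + θ)⁻¹ • w = (y₂ - y₀) • b := by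
        rw [sub_smul, ← add_sub_add_left_eq_sub _ _ x, ← e₂, ← e₀, add_sub_cancel_left]
      rw [mul_smul, ← this, smul_smul, mul_inv_cancel₀ hθ1, one_smul]
    have hb : b ≠ 0 := by
      rintro rfl
      exact hw (by rw [f₁, smul_zero])
    have f : θ * (y₁ - y₀) = (1 + θ) * (y₂ - y₀) := smul_left_injective K hb (f₁.symm.trans f₂)
    have hy : y₁ - y₂ ≠ 0 := by
      intro h
      have h' : y₂ - y₀ = 0 := by linear_combination -f + θ * h
      exact hw (by rw [f₂, h', mul_zero, zero_smul])
    have hθL : θ ∈ L := by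
      have : θ = (y₂ - y₀) / (y₁ - y₂) := by
        field_simp
        linear_combination f
      rw [this]
      exact L.div_mem (L.sub_mem hy₂ hy₀) (L.sub_mem hy₁ hy₂)
    exact LinearMap.finrank_le_finrank_of_injective
      (f := Subalgebra.toSubmodule.monotone (adjoin_simple_le_iff.2 hθL) |> Submodule.inclusion)
      (Submodule.inclusion_injective _)
  have hw' : ((w.1, w.2, 0) : K × K × K) ≠ 0 := fun h => hw (by
    simp only [Prod.mk_eq_zero] at h
    exact Prod.ext h.1 h.2.1)
  -- The tangent subline `{a + y w : y ∈ F(θ)}` works, since `1/(c + θ) ∈ F(θ)` for `c ∈ E`.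
  have exist : ∃ m', IsSubline F K (Module.finrank F F⟮θ⟯) m' ∧ IsTangent m' ∧ m ⊆ m' := by
    refine ⟨_, ⟨F⟮θ⟯, (w.1, w.2, 0), (a.1, a.2, 1), rfl, ?_, rfl⟩, ?_, ?_⟩
    · rw [LinearIndependent.pair_iff]
      intro s t h
      simp only [Prod.smul_mk, smul_eq_mul, Prod.mk_add_mk, Prod.mk_eq_zero] at h
      obtain ⟨h1, h2, h3⟩ := h
      have ht : t = 0 := by simpa using h3
      subst ht
      refine ⟨?_, rfl⟩
      by_contra hs
      exact hw (Prod.ext (by simpa [hs] using h1) (by simpa [hs] using h2))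
    · refine ⟨Projectivization.mk K _ hw', ⟨mem_subline_iff.2 (Or.inl (isCoord_mk _)),
        (isCoord_mk _).le_infinity.2 rfl⟩, ?_⟩
      rintro P ⟨hP, hinf⟩
      obtain hP | ⟨c, -, hP⟩ := mem_subline_iff.1 hP
      · exact hP.unique (isCoord_mk _)
      · simpa using hP.le_infinity.1 hinf
    · intro P hP
      rw [hm, affineSet_eq_image] at hP
      obtain ⟨p, hp, rfl⟩ := hP
      refine mem_subline_iff.2 (Or.inr ?_)
      have hcoord : ∀ c : K, p = a + c • w →
          IsCoord (affinePt K p) (c • ((w.1, w.2, 0) : K × K × K) + (a.1, a.2, 1)) := by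
        rintro c rfl
        convert isCoord_affinePt (R := K) (a + c • w) using 1
        ext <;> simp [add_comm]
      obtain rfl | ⟨c, hc, rfl⟩ := hp
      · exact ⟨0, zero_mem _, hcoord 0 (by simp)⟩
      · exact ⟨_, inv_mem (add_mem (hE hc) (mem_adjoin_simple_self F θ)), hcoord _ rfl⟩
  constructor
  · rintro ⟨⟨m', h1, h2, h3⟩, h⟩
    obtain ⟨m₁, g1, g2, g3⟩ := exist
    exact le_antisymm (lower _ _ h1 h2 h3) (h _ _ g1 g2 g3)
  · rintro rfl
    exact ⟨exist, lower⟩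

end ABB

/-! ### The span of a subline -/

namespace ABB

open IntermediateField Polynomial

variable {F K : Type*} [Field F] [Field K] [Algebra F K]

/-- Partial fractions: the elements `(c + θ)⁻¹`, `c ∈ F`, span `F(θ)` if `F` has at least
`[F(θ) : F]` elements. -/
theorem mem_span_inv_add [Fintype F] [FiniteDimensional F K] {θ : K}
    (hθ : θ ∉ (⊥ : IntermediateField F K))
    (hcard : Module.finrank F F⟮θ⟯ ≤ Fintype.card F) {z : K} (hz : z ∈ F⟮θ⟯) :
    z ∈ Submodule.span F (Set.range fun c : F => (algebraMap F K c + θ)⁻¹) := by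
  classical
  have hint : IsIntegral F θ := IsIntegral.of_finite F θ
  have hrep : ∀ y ∈ F⟮θ⟯, ∃ h : F[X], h.degree < Fintype.card F ∧ aeval θ h = y := by
    intro y hy
    rw [← mem_toSubalgebra, adjoin_simple_toSubalgebra_of_isAlgebraic hint.isAlgebraic,
      Algebra.adjoin_singleton_eq_range_aeval] at hy
    obtain ⟨g, rfl⟩ := hy
    refine ⟨g %ₘ minpoly F θ, ?_, aeval_modByMonic_eq_self_of_root (minpoly.aeval F θ)⟩
    refine (degree_modByMonic_lt _ (minpoly.monic hint)).trans_le ?_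
    rw [degree_eq_natDegree (minpoly.ne_zero hint), ← adjoin.finrank hint]
    exact_mod_cast hcard
  set v : F → K := fun c => -algebraMap F K c with hv
  have hvinj : Set.InjOn v (Finset.univ : Finset F) := fun c _ d _ h =>
    (algebraMap F K).injective (neg_injective h)
  have hvne : ∀ i ∈ (Finset.univ : Finset F), θ ≠ v i := fun i _ h =>
    hθ (by rw [h]; exact neg_mem (IntermediateField.algebraMap_mem _ _))
  set N := eval θ (Lagrange.nodal Finset.univ v) with hN
  have hN0 : N ≠ 0 := Lagrange.eval_nodal_not_at_node hvne
  have hNmem : N ∈ F⟮θ⟯ := by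
    rw [hN, Lagrange.eval_nodal]
    exact prod_mem fun i _ => sub_mem (mem_adjoin_simple_self F θ) (neg_mem (IntermediateField.algebraMap_mem _ _))
  -- `N` is the product of all `θ + c`. As `deg h < q`, Lagrange interpolation at the `q` nodes `-c`
  -- is exact, and dividing `h(θ) = N z` by `N` gives the partial fraction expansion of `z`, with
  -- coefficients in `F`.
  obtain ⟨h, hdeg, hh⟩ := hrep _ (mul_mem hNmem hz)
  have hint := Lagrange.eq_interpolate_of_eval_eq (f := h.map (algebraMap F K)) (s := Finset.univ)
    (v := v) (fun c => algebraMap F K (h.eval (-c))) hvinj (by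
      rw [degree_map]
      exact hdeg) (fun i _ => by
      change eval (-algebraMap F K i) _ = _
      rw [← map_neg, eval_map_apply])
  have hev := congrArg (eval θ) hint
  rw [Lagrange.eval_interpolate_not_at_node _ hvne, eval_map_algebraMap, hh] at hev
  rw [mul_left_cancel₀ hN0 hev]
  refine Submodule.sum_mem _ fun i _ => ?_
  have hw : ∃ d : F, Lagrange.nodalWeight Finset.univ v i = algebraMap F K d := by
    refine ⟨∏ j ∈ Finset.univ.erase i, (-i - -j)⁻¹, ?_⟩
    rw [Lagrange.nodalWeight, map_prod]
    exact Finset.prod_congr rfl fun j _ => by rw [hv, map_inv₀, map_sub, map_neg, map_neg]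
  obtain ⟨d, hd⟩ := hw
  have : Lagrange.nodalWeight Finset.univ v i * (θ - v i)⁻¹ * algebraMap F K (h.eval (-i)) =
      (d * h.eval (-i)) • (algebraMap F K i + θ)⁻¹ := by
    rw [hd, Algebra.smul_def, map_mul, hv, sub_neg_eq_add, add_comm θ]
    ring
  rw [this]
  exact Submodule.smul_mem _ _ (Submodule.subset_span ⟨i, rfl⟩)

theorem spreadMap_injective {w : K × K} (hw : w ≠ 0) :
    Function.Injective (spreadMap F K w.1 w.2) := by
  intro x y h
  have h1 : w.1 * x = w.1 * y := congrArg Prod.fst h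
  have h2 : w.2 * x = w.2 * y := congrArg (fun v => v.2.1) h
  by_contra hne
  refine hw (Prod.ext ?_ ?_)
  · by_contra h0
    exact hne (mul_left_cancel₀ h0 h1)
  · by_contra h0
    exact hne (mul_left_cancel₀ h0 h2)

theorem isCoord_mem_spanPts {V : Type*} [AddCommGroup V] [Module F V] {S : Set (ℙ F V)} {P : ℙ F V}
    {v : V} (hP : P ∈ S) (h : IsCoord P v) : v ∈ spanPts S :=
  Submodule.mem_iSup_of_mem P (Submodule.mem_iSup_of_mem hP h.mem)

/-- The upper bound holds because all `1/(c + θ)` lie in `F(θ)`; for the lower bound the parameters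
`c ∈ F` already suffice. -/
theorem spanPts_lineSet [Fintype F] [FiniteDimensional F K] {E : IntermediateField F K}
    {a w : K × K} {θ : K} (hθ : θ ∉ E) (hE : E ≤ F⟮θ⟯)
    (hcard : Module.finrank F F⟮θ⟯ ≤ Fintype.card F) :
    spanPts (affineSet F (lineSet (E : Set K) a w θ)) =
      Submodule.span F {((a.1, a.2, 1) : K × K × F)} ⊔
        F⟮θ⟯.toSubalgebra.toSubmodule.map (spreadMap F K w.1 w.2) := by
  have hdecomp : ∀ x : K, (((a + x • w).1, (a + x • w).2, 1) : K × K × F) =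
      (a.1, a.2, 1) + spreadMap F K w.1 w.2 x := by
    intro x
    ext <;> simp [spreadMap, mul_comm]
  apply le_antisymm
  · refine iSup₂_le fun P hP => ?_
    rw [affineSet_eq_image] at hP
    obtain ⟨p, hp, rfl⟩ := hP
    rw [(isCoord_affinePt p).submodule_eq, Submodule.span_singleton_le_iff_mem]
    obtain rfl | ⟨c, hc, rfl⟩ := hp
    · exact Submodule.mem_sup_left (Submodule.mem_span_singleton_self _)
    · simp only [hdecomp]
      refine Submodule.add_mem_sup (Submodule.mem_span_singleton_self _)
        (Submodule.mem_map_of_mem ?_)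
      exact F⟮θ⟯.inv_mem (add_mem (hE hc) (mem_adjoin_simple_self F θ))
  · have ha : ((a.1, a.2, 1) : K × K × F) ∈ spanPts (affineSet F (lineSet (E : Set K) a w θ)) :=
      isCoord_mem_spanPts (affinePt_mem_affineSet.2 base_mem_lineSet) (isCoord_affinePt a)
    refine sup_le ((Submodule.span_singleton_le_iff_mem _ _).2 ha) ?_
    have hb : θ ∉ (⊥ : IntermediateField F K) := fun h => hθ (bot_le (a := E) h)
    refine (Submodule.map_mono fun z hz => mem_span_inv_add hb hcard hz).trans ?_
    rw [Submodule.map_span_le]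
    rintro _ ⟨c, rfl⟩
    have hc := isCoord_mem_spanPts (affinePt_mem_affineSet.2 (mem_lineSet (a := a) (w := w) (θ := θ)
      (E.algebraMap_mem c))) (isCoord_affinePt (R := F) _)
    rw [hdecomp] at hc
    exact (Submodule.add_mem_iff_right _ ha).1 hc

theorem spansOverSpread_lineSet [Fintype F] [FiniteDimensional F K] {E : IntermediateField F K}
    {a w : K × K} {θ : K} (hw : w ≠ 0) (hθ : θ ∉ E) (hE : E ≤ F⟮θ⟯)
    (hcard : Module.finrank F F⟮θ⟯ ≤ Fintype.card F) :
    SpansOverSpread F K (Module.finrank F F⟮θ⟯) (affineSet F (lineSet (E : Set K) a w θ)) := by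
  rw [SpansOverSpread, spanPts_lineSet hθ hE hcard]
  set S := F⟮θ⟯.toSubalgebra.toSubmodule.map (spreadMap F K w.1 w.2) with hS
  set A := Submodule.span F {((a.1, a.2, 1) : K × K × F)} with hA
  have hSinf : S ≤ infinity F K := by
    rintro _ ⟨x, -, rfl⟩
    simp [infinity, spreadMap]
  have hAinf : A ⊓ infinity F K = ⊥ := by
    rw [eq_bot_iff]
    rintro v ⟨hv, hv'⟩
    obtain ⟨c, rfl⟩ := Submodule.mem_span_singleton.1 hv
    have : c = 0 := by simpa [infinity] using hv'
    simp [this]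
  constructor
  · have h := Submodule.finrank_sup_add_finrank_inf_eq A S
    rw [eq_bot_iff.2 ((inf_le_inf_left A hSinf).trans hAinf.le), finrank_bot, add_zero,
      finrank_span_singleton (affine_ne_zero a), hS,
      ← (Submodule.equivMapOfInjective _ (spreadMap_injective hw) _).finrank_eq] at h
    rw [h, add_comm]
    rfl
  · refine ⟨F⟮θ⟯, w.1, w.2, rfl, hw, ?_⟩
    rw [sup_comm, sup_inf_assoc_of_le _ hSinf, hAinf, sup_bot_eq]

end ABB

namespace ABB

open IntermediateField Polynomial

/-! ### Powers of Frobenius -/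

section Frobenius

variable (F K : Type*) [Field F] [Fintype F] [Field K] [Algebra F K]

/-- The `m`-th power of the Frobenius endomorphism `x ↦ x ^ q`. -/
def frobPow (m : ℕ) : K →ₐ[F] K := FiniteField.frobeniusAlgHom F K ^ m

variable {F K}

theorem frobPow_apply (m : ℕ) (x : K) : frobPow F K m x = x ^ Fintype.card F ^ m := by
  rw [frobPow, AlgHom.coe_pow, FiniteField.coe_frobeniusAlgHom, pow_iterate]

theorem frobPow_frobPow (m l : ℕ) (x : K) :
    frobPow F K m (frobPow F K l x) = frobPow F K (l + m) x := by
  rw [add_comm, frobPow, frobPow, frobPow, pow_add]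
  rfl

theorem frobPow_zero : frobPow F K 0 = AlgHom.id F K := pow_zero _

theorem frobPow_eq_of_cast_eq [Finite K] {m l : ℕ}
    (h : (m : ZMod (Module.finrank F K)) = l) : frobPow F K m = frobPow F K l := by
  have h' : m % Module.finrank F K = l % Module.finrank F K :=
    (ZMod.natCast_eq_natCast_iff _ _ _).1 h
  rw [← FiniteField.orderOf_frobeniusAlgHom] at h'
  rw [frobPow, frobPow, ← pow_mod_orderOf _ m, h', pow_mod_orderOf]

/-- Being fixed means being a root of `X^(q^m) - X`, the product of all monic irreducibles over `F`
of degree dividing `m`. -/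
theorem frobPow_eq_self_iff [Finite K] (η : K) (m : ℕ) :
    frobPow F K m η = η ↔ (minpoly F η).natDegree ∣ m := by
  have hint : IsIntegral F η := IsIntegral.of_finite F η
  rw [(minpoly.irreducible hint).natDegree_dvd_iff_dvd_X_pow_card_pow_sub_X, minpoly.dvd_iff,
    frobPow_apply, Nat.card_eq_fintype_card]
  simp [sub_eq_zero]

theorem exists_frobPow_of_root [Finite K] {η x : K} (h : aeval x (minpoly F η) = 0) :
    ∃ m < (minpoly F η).natDegree, x = frobPow F K m η := by
  have hint : IsIntegral F η := IsIntegral.of_finite F η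
  obtain ⟨σ, rfl⟩ := minpoly.exists_algEquiv_of_root' hint.isAlgebraic h
  obtain ⟨i, hi⟩ := (FiniteField.bijective_frobeniusAlgHom_pow F K).2 (σ : K →ₐ[F] K)
  refine ⟨i % (minpoly F η).natDegree, Nat.mod_lt _ (minpoly.natDegree_pos hint), ?_⟩
  have h1 : σ η = frobPow F K i η := (DFunLike.congr_fun hi η).symm
  rw [h1]
  conv_lhs => rw [← Nat.div_add_mod (i : ℕ) (minpoly F η).natDegree, ← frobPow_frobPow,
    (frobPow_eq_self_iff η _).2 (dvd_mul_right _ _)]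

end Frobenius

/-! ### Coordinate polynomials of a rational curve -/

section CoordPoly

variable {R : Type*} [Field R] {d : ℕ}

/-- The polynomial `∑ e_i X^(d-i)`. -/
def coordPoly (e : Fin (d + 1) → R) : R[X] := ∑ i, C (e i) * X ^ (d - (i : ℕ))

theorem coordPoly_coeff (e : Fin (d + 1) → R) (i : Fin (d + 1)) :
    (coordPoly e).coeff (d - i) = e i := by
  rw [coordPoly, finsetSum_coeff, Finset.sum_eq_single i]
  · simp
  · intro j _ hj
    rw [coeff_C_mul, coeff_X_pow, if_neg, mul_zero]
    intro h
    exact hj (Fin.ext (by have := i.2; have := j.2; omega))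
  · simp

theorem natDegree_coordPoly_le (e : Fin (d + 1) → R) : (coordPoly e).natDegree ≤ d :=
  natDegree_sum_le_of_forall_le _ _ fun _ _ =>
    (natDegree_C_mul_X_pow_le _ _).trans (Nat.sub_le _ _)

theorem coordPoly_of_coeff {p : R[X]} (hp : p.natDegree ≤ d) :
    coordPoly (fun i : Fin (d + 1) => p.coeff (d - i)) = p := by
  ext m
  by_cases hm : m ≤ d
  · have := coordPoly_coeff (fun i : Fin (d + 1) => p.coeff (d - i)) ⟨d - m, by omega⟩
    simpa [Nat.sub_sub_self hm] using this
  · rw [coeff_eq_zero_of_natDegree_lt ((natDegree_coordPoly_le _).trans_lt (not_le.1 hm)),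
      coeff_eq_zero_of_natDegree_lt (hp.trans_lt (not_le.1 hm))]

theorem eval_coordPoly (e : Fin (d + 1) → R) (c : R) :
    eval c (coordPoly e) = ∑ i : Fin (d + 1), c ^ (d - (i : ℕ)) * e i := by
  rw [coordPoly, eval_finsetSum]
  exact Finset.sum_congr rfl fun i _ => by
    rw [eval_mul, eval_C, eval_pow, eval_X, mul_comm]

theorem map_coordPoly {S : Type*} [Field S] (f : R →+* S) (e : Fin (d + 1) → R) :
    (coordPoly e).map f = coordPoly (f ∘ e) := by
  rw [coordPoly, coordPoly, Polynomial.map_sum]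
  exact Finset.sum_congr rfl fun i _ => by simp

variable {V : Type*} [AddCommGroup V] [Module R V]

/-- The points of a rational curve, with an inhomogeneous parameter. -/
theorem mem_ratCurve_iff {e : Fin (d + 1) → V} {P : ℙ R V} :
    P ∈ ratCurve e ↔ IsCoord P (e 0) ∨
      ∃ c : R, IsCoord P (∑ i : Fin (d + 1), c ^ (d - (i : ℕ)) • e i) := by
  have hzero : ∀ s : R, ∑ i : Fin (d + 1), (s ^ (d - (i : ℕ)) * 0 ^ (i : ℕ)) • e i =
      s ^ d • e 0 := by
    intro s
    rw [Finset.sum_eq_single 0]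
    · simp
    · intro i _ hi
      rw [zero_pow, mul_zero, zero_smul]
      exact fun h => hi (Fin.ext h)
    · simp
  constructor
  · rintro ⟨s, t, h⟩
    by_cases ht : t = 0
    · subst ht
      rw [hzero] at h
      refine Or.inl ((isCoord_smul_iff ?_).1 h)
      intro h0
      exact h.ne_zero (by rw [h0, zero_smul])
    · refine Or.inr ⟨s / t, ?_⟩
      rw [← isCoord_smul_iff (pow_ne_zero d ht), Finset.smul_sum]
      have : ∀ i : Fin (d + 1), t ^ d • (s / t) ^ (d - (i : ℕ)) • e i =
          (s ^ (d - (i : ℕ)) * t ^ (i : ℕ)) • e i := by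
        intro i
        have : t ^ d = t ^ (d - (i : ℕ)) * t ^ (i : ℕ) := by
          rw [← pow_add, Nat.sub_add_cancel (Nat.lt_succ_iff.1 i.2)]
        rw [smul_smul, div_pow, this]
        congr 1
        field_simp
      simpa only [this] using h
  · rintro (h | ⟨c, h⟩)
    · exact ⟨1, 0, by rw [hzero]; simpa using h⟩
    · exact ⟨c, 1, by simpa using h⟩

end CoordPoly

/-! ### The collineation σ, extended curves and supports -/

section Sigma

variable {F K : Type*} [Field F] [Fintype F] [Field K] [Algebra F K]

theorem IsCoord.sigma {P : StarSpace F K} {v : StarVec F K} (h : IsCoord P v) :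
    IsCoord (sigma F K P) (sigmaVec F K v) := by
  obtain ⟨h, rfl⟩ := h
  exact ⟨(map_ne_zero_iff _ (sigmaVec_injective F K)).2 h, Projectivization.map_mk ..⟩

theorem IsCoord.sigma_iterate {P : StarSpace F K} {v : StarVec F K} (h : IsCoord P v) (m : ℕ) :
    IsCoord ((ABB.sigma F K)^[m] P) ((sigmaVec F K)^[m] v) := by
  induction m with
  | zero => exact h
  | succ m ih =>
    rw [Function.iterate_succ_apply', Function.iterate_succ_apply']
    exact ih.sigma

theorem emb_fst (v : K × K × F) (i : ZMod (Module.finrank F K)) :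
    (emb F K v).1 i = frobPow F K i.val v.1 := (frobPow_apply _ _).symm

theorem emb_snd (v : K × K × F) (i : ZMod (Module.finrank F K)) :
    (emb F K v).2.1 i = frobPow F K i.val v.2.1 := (frobPow_apply _ _).symm

/-- The Frobenius power compensates the index shift; the wrap-around is harmless because Frobenius
has order `n` on `K`. -/
theorem sigmaVec_emb [Finite K] (v : K × K × F) : sigmaVec F K (emb F K v) = emb F K v := by
  have : NeZero (Module.finrank F K) := ⟨Module.finrank_pos.ne'⟩
  have key : ∀ (x : K) (i : ZMod (Module.finrank F K)),
      (frobPow F K (i - 1).val x) ^ Fintype.card F = frobPow F K i.val x := by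
    intro x i
    have h1 : ∀ y : K, y ^ Fintype.card F = frobPow F K 1 y := fun y => by
      rw [frobPow_apply, pow_one]
    rw [h1, frobPow_frobPow]
    exact DFunLike.congr_fun (frobPow_eq_of_cast_eq (by simp)) x
  refine Prod.ext (funext fun i => ?_) (Prod.ext (funext fun i => ?_) ?_)
  · change (emb F K v).1 (i - 1) ^ _ = _
    rw [emb_fst, emb_fst, key]
  · change (emb F K v).2.1 (i - 1) ^ _ = _
    rw [emb_snd, emb_snd, key]
  · change (algebraMap F K v.2.2) ^ _ = algebraMap F K v.2.2
    rw [← map_pow, FiniteField.pow_card]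

/-- The point with parameter `c` on the extension of a rational curve. -/
def curveVec {d : ℕ} (e : Fin (d + 1) → K × K × F) (c : K) : StarVec F K :=
  ∑ i : Fin (d + 1), c ^ (d - (i : ℕ)) • emb F K (e i)

/-- Index `j` conjugates the coefficients of the coordinate polynomials but leaves the parameter `c`
untouched. -/
theorem curveVec_eq {d : ℕ} (e : Fin (d + 1) → K × K × F) (c : K) :
    curveVec e c =
      (fun j => eval c ((coordPoly fun i => (e i).1).map (frobPow F K j.val : K →+* K)),
        fun j => eval c ((coordPoly fun i => (e i).2.1).map (frobPow F K j.val : K →+* K)),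
        aeval c (coordPoly fun i => (e i).2.2)) := by
  refine Prod.ext (funext fun i => ?_) (Prod.ext (funext fun i => ?_) ?_)
  · simp only [curveVec, Prod.fst_sum, Finset.sum_apply, Prod.smul_fst, Pi.smul_apply, emb_fst,
      map_coordPoly, eval_coordPoly]
    rfl
  · simp only [curveVec, Prod.fst_sum, Prod.snd_sum, Finset.sum_apply, Prod.smul_fst,
      Prod.smul_snd, Pi.smul_apply, emb_snd, map_coordPoly, eval_coordPoly]
    rfl
  · simp only [curveVec, Prod.snd_sum, Prod.smul_snd, ← eval_map_algebraMap, map_coordPoly,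
      eval_coordPoly]
    rfl

/-- The coefficient vectors are fixed by `σ`, so only the parameter is moved. -/
theorem sigmaVec_iterate_curveVec [Finite K] {d : ℕ} (e : Fin (d + 1) → K × K × F) (c : K)
    (m : ℕ) : (sigmaVec F K)^[m] (curveVec e c) = curveVec e (frobPow F K m c) := by
  have h1 : ∀ c, sigmaVec F K (curveVec e c) = curveVec e (frobPow F K 1 c) := by
    intro c
    rw [curveVec, curveVec, map_sum]
    refine Finset.sum_congr rfl fun i _ => ?_
    rw [LinearMap.map_smulₛₗ, sigmaVec_emb, frobPow, pow_one, map_pow]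
    rfl
  induction m with
  | zero => rw [frobPow_zero]; rfl
  | succ m ih => rw [Function.iterate_succ_apply', ih, h1, frobPow_frobPow]

variable (F K) in
/-- The vectors at infinity supported on the indices congruent to `j` modulo `r`. -/
def suppSub (r : ℕ) (j : ZMod r) : Submodule K (StarVec F K) where
  carrier := {v | v.2.2 = 0 ∧ ∀ i, ((i.val : ℕ) : ZMod r) ≠ j → v.1 i = 0 ∧ v.2.1 i = 0}
  add_mem' := by
    rintro v w ⟨h, h'⟩ ⟨g, g'⟩
    refine ⟨by simp [h, g], fun i hi => ⟨?_, ?_⟩⟩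
    · simp [(h' i hi).1, (g' i hi).1]
    · simp [(h' i hi).2, (g' i hi).2]
  zero_mem' := ⟨rfl, fun _ _ => ⟨rfl, rfl⟩⟩
  smul_mem' := by
    rintro c v ⟨h, h'⟩
    refine ⟨by simp [h], fun i hi => ⟨?_, ?_⟩⟩
    · simp [(h' i hi).1]
    · simp [(h' i hi).2]

theorem suppSub_disjoint {r : ℕ} {j j' : ZMod r} {v : StarVec F K} (h : v ∈ suppSub F K r j)
    (h' : v ∈ suppSub F K r j') (hv : v ≠ 0) : j = j' := by
  by_contra hne
  refine hv (Prod.ext (funext fun i => ?_) (Prod.ext (funext fun i => ?_) h.1))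
  · by_cases hi : ((i.val : ℕ) : ZMod r) = j
    · exact (h'.2 i (fun h => hne (hi.symm.trans h))).1
    · exact (h.2 i hi).1
  · by_cases hi : ((i.val : ℕ) : ZMod r) = j
    · exact (h'.2 i (fun h => hne (hi.symm.trans h))).2
    · exact (h.2 i hi).2

/-- As `r ∣ n`, reduction of indices from `ZMod n` to `ZMod r` is a ring homomorphism and respects
the shift by one. -/
theorem sigmaVec_mem_suppSub [Finite K] {r : ℕ} (hr : r ∣ Module.finrank F K) {j : ZMod r}
    {v : StarVec F K} (h : v ∈ suppSub F K r j) : sigmaVec F K v ∈ suppSub F K r (j + 1) := by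
  have : NeZero (Module.finrank F K) := ⟨Module.finrank_pos.ne'⟩
  have hq : Fintype.card F ≠ 0 := Fintype.card_ne_zero
  refine ⟨?_, fun i hi => ?_⟩
  · change v.2.2 ^ _ = 0
    rw [h.1, zero_pow hq]
  · have hi' : (((i - 1).val : ℕ) : ZMod r) ≠ j := by
      rintro rfl
      apply hi
      rw [ZMod.natCast_val, ZMod.natCast_val, ← ZMod.castHom_apply (h := hr),
        ← ZMod.castHom_apply (h := hr), map_sub, map_one, sub_add_cancel]
    refine ⟨?_, ?_⟩
    · change v.1 (i - 1) ^ _ = 0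
      rw [(h.2 _ hi').1, zero_pow hq]
    · change v.2.1 (i - 1) ^ _ = 0
      rw [(h.2 _ hi').2, zero_pow hq]

theorem sigma_iterate_le_suppSub [Finite K] {r : ℕ} (hr : r ∣ Module.finrank F K) {j : ZMod r}
    {P : StarSpace F K} (h : P.submodule ≤ suppSub F K r j) (m : ℕ) :
    ((sigma F K)^[m] P).submodule ≤ suppSub F K r (j + m) := by
  obtain ⟨v, hv⟩ := exists_isCoord P
  rw [(hv.sigma_iterate m).submodule_eq, Submodule.span_singleton_le_iff_mem]
  have hmem := h hv.mem
  clear h hv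
  induction m with
  | zero => simpa using hmem
  | succ m ih =>
    rw [Function.iterate_succ_apply', Nat.cast_succ, ← add_assoc]
    exact sigmaVec_mem_suppSub hr ih

theorem directorSpace_le_suppSub [Finite K] {r : ℕ} (hr : r ∣ Module.finrank F K)
    {P : StarSpace F K} (h : P ∈ directorSpace F K r) : P.submodule ≤ suppSub F K r 0 := by
  have : NeZero (Module.finrank F K) := ⟨Module.finrank_pos.ne'⟩
  refine h.1.trans (iSup₂_le fun Q hQ => ?_)
  simp only [Set.mem_iUnion] at hQ
  obtain ⟨j, -, Q, ⟨a, b, hab⟩, rfl⟩ := hQ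
  have h0 : Q.submodule ≤ suppSub F K r 0 := by
    rw [hab.submodule_eq, Submodule.span_singleton_le_iff_mem]
    refine ⟨rfl, fun i hi => ?_⟩
    have : i ≠ 0 := by
      rintro rfl
      simp at hi
    exact ⟨Pi.single_eq_of_ne this _, Pi.single_eq_of_ne this _⟩
  simpa using sigma_iterate_le_suppSub hr h0 (r * j)

theorem mem_indicatorPoints_le [Finite K] {r : ℕ} (hr : r ∣ Module.finrank F K)
    {P : StarSpace F K} (h : P ∈ indicatorPoints F K r) :
    ∃ i < r, P.submodule ≤ suppSub F K r i := by
  simp only [indicatorPoints, Set.mem_iUnion] at h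
  obtain ⟨i, hi, Q, hQ, rfl⟩ := h
  refine ⟨i, hi, ?_⟩
  simpa using sigma_iterate_le_suppSub hr (directorSpace_le_suppSub hr hQ) i

theorem sigmaVec_iterate_single (x y : K) (m : ℕ) :
    (sigmaVec F K)^[m] (Pi.single 0 x, Pi.single 0 y, 0) =
      (Pi.single (m : ZMod (Module.finrank F K)) (frobPow F K m x),
        Pi.single (m : ZMod (Module.finrank F K)) (frobPow F K m y), 0) := by
  have hq : Fintype.card F ≠ 0 := Fintype.card_ne_zero
  have h1 : ∀ y : K, y ^ Fintype.card F = frobPow F K 1 y := fun y => by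
    rw [frobPow_apply, pow_one]
  have hs : ∀ (m i : ZMod (Module.finrank F K)) (z : K),
      (Pi.single m z : ZMod (Module.finrank F K) → K) (i - 1) ^ Fintype.card F =
        (Pi.single (m + 1) (frobPow F K 1 z) : ZMod (Module.finrank F K) → K) i := by
    intro m i z
    by_cases h : i = m + 1
    · subst h
      simp [h1]
    · rw [Pi.single_eq_of_ne h, Pi.single_eq_of_ne (fun h' => h (by rw [← h']; ring)),
        zero_pow hq]
  induction m with
  | zero => simp [frobPow_zero]
  | succ m ih =>
    rw [Function.iterate_succ_apply', ih]
    refine Prod.ext (funext fun i => ?_) (Prod.ext (funext fun i => ?_) (zero_pow hq))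
    · refine (hs _ _ _).trans ?_
      rw [frobPow_frobPow, Nat.cast_succ]
    · refine (hs _ _ _).trans ?_
      rw [frobPow_frobPow, Nat.cast_succ]

end Sigma

end ABB

/-! ### Sublines over `F` are special curves -/

namespace ABB

open IntermediateField Polynomial

variable {F K : Type*} [Field F] [Field K] [Algebra F K]

theorem eval_minpolyDiv_mul (η c : K) :
    eval c (minpolyDiv F η) * (c - η) = aeval c (minpoly F η) := by
  rw [← eval_map_algebraMap, ← minpolyDiv_spec, eval_mul, eval_sub, eval_X, eval_C]

theorem aeval_minpoly_ne_zero [FiniteDimensional F K] {η : K}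
    (hη : η ∉ (⊥ : IntermediateField F K)) (c : F) :
    aeval (algebraMap F K c) (minpoly F η) ≠ 0 := by
  intro h
  rw [aeval_algebraMap_apply, coe_aeval_eq_eval, FaithfulSMul.algebraMap_eq_zero_iff] at h
  have hint := IsIntegral.of_finite F η
  have h1 : _ = 1 := natDegree_eq_of_degree_eq_some
    (degree_eq_one_of_irreducible_of_root (minpoly.irreducible hint) h)
  rw [minpoly.natDegree_eq_one_iff] at h1
  exact hη (IntermediateField.mem_bot.2 h1)

/-- The vectors `(δ f(c) a + δ g(c) w, δ f(c))` describe a subline over `F`. -/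
theorem ratCurve_eq_affineSet [FiniteDimensional F K] {d : ℕ} {e : Fin (d + 1) → K × K × F}
    {a w : K × K} {η : K} {δ : F} (hδ : δ ≠ 0) (hη : η ∉ (⊥ : IntermediateField F K))
    (hd : (minpoly F η).natDegree = d)
    (h₁ : coordPoly (fun i => (e i).1) = C (algebraMap F K δ) *
      (C a.1 * (minpoly F η).map (algebraMap F K) + C w.1 * minpolyDiv F η))
    (h₂ : coordPoly (fun i => (e i).2.1) = C (algebraMap F K δ) *
      (C a.2 * (minpoly F η).map (algebraMap F K) + C w.2 * minpolyDiv F η))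
    (h₃ : coordPoly (fun i => (e i).2.2) = C δ * minpoly F η) :
    ratCurve e = affineSet F (lineSet ((⊥ : IntermediateField F K) : Set K) a w (-η)) := by
  have hint := IsIntegral.of_finite F η
  have hf : (minpoly F η).coeff d = 1 := by
    rw [← hd]
    exact minpoly.monic hint
  have hg : (minpolyDiv F η).coeff d = 0 :=
    coeff_eq_zero_of_natDegree_lt (by rw [← hd]; exact natDegree_minpolyDiv_lt hint)
  -- `e 0` collects the coefficients of degree `d`, where `f` has `1` and `g` has `0`: the parameter
  -- `∞` gives the base point.
  have he0 : e 0 = δ • ((a.1, a.2, 1) : K × K × F) := by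
    refine Prod.ext ?_ (Prod.ext ?_ ?_)
    · have := coordPoly_coeff (fun i => (e i).1) 0
      simp only [Fin.val_zero, Nat.sub_zero] at this
      rw [← this, h₁]
      simp [hf, hg, Algebra.smul_def]
    · have := coordPoly_coeff (fun i => (e i).2.1) 0
      simp only [Fin.val_zero, Nat.sub_zero] at this
      rw [← this, h₂]
      simp [hf, hg, Algebra.smul_def]
    · have := coordPoly_coeff (fun i => (e i).2.2) 0
      simp only [Fin.val_zero, Nat.sub_zero] at this
      rw [← this, h₃]
      simp [hf]
  have hsum : ∀ c : F, ∑ i : Fin (d + 1), c ^ (d - (i : ℕ)) • e i =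
      (δ * (minpoly F η).eval c) • (((a + (algebraMap F K c + -η)⁻¹ • w).1,
        (a + (algebraMap F K c + -η)⁻¹ • w).2, 1) : K × K × F) := by
    intro c
    have hev : algebraMap F K ((minpoly F η).eval c) =
        aeval (algebraMap F K c) (minpoly F η) := by
      rw [aeval_algebraMap_apply, coe_aeval_eq_eval]
    have hne : algebraMap F K c + -η ≠ 0 :=
      add_ne_zero_of_notMem (fun h => hη (neg_mem_iff.1 h)) (IntermediateField.algebraMap_mem _ _)
    have hdiv : eval (algebraMap F K c) (minpolyDiv F η) =
        algebraMap F K ((minpoly F η).eval c) * (algebraMap F K c + -η)⁻¹ := by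
      rw [hev, ← eval_minpolyDiv_mul, ← sub_eq_add_neg, mul_inv_cancel_right₀]
      rwa [sub_eq_add_neg]
    refine Prod.ext ?_ (Prod.ext ?_ ?_)
    · have := eval_coordPoly (fun i => (e i).1) (algebraMap F K c)
      simp only [Prod.fst_sum, Prod.smul_fst]
      simp only [Algebra.smul_def, map_pow]
      rw [← this, h₁]
      simp [hdiv, ← hev]
      ring
    · have := eval_coordPoly (fun i => (e i).2.1) (algebraMap F K c)
      simp only [Prod.fst_sum, Prod.snd_sum, Prod.smul_fst, Prod.smul_snd]
      simp only [Algebra.smul_def, map_pow]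
      rw [← this, h₂]
      simp [hdiv, ← hev]
      ring
    · have := eval_coordPoly (fun i => (e i).2.2) c
      simp only [Prod.snd_sum, Prod.smul_snd, smul_eq_mul]
      rw [← this, h₃]
      simp
  have hne : ∀ c : F, δ * (minpoly F η).eval c ≠ 0 := by
    intro c
    refine mul_ne_zero hδ fun h => aeval_minpoly_ne_zero hη c ?_
    rw [aeval_algebraMap_apply, coe_aeval_eq_eval, h, map_zero]
  ext P
  simp only [mem_ratCurve_iff, he0, hsum, isCoord_smul_iff hδ, isCoord_smul_iff (hne _),
    isCoord_affine_iff, affineSet_eq_image]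
  constructor
  · rintro (rfl | ⟨c, rfl⟩)
    · exact ⟨a, base_mem_lineSet, rfl⟩
    · exact ⟨_, mem_lineSet (IntermediateField.algebraMap_mem _ c), rfl⟩
  · rintro ⟨p, rfl | ⟨c, hc, rfl⟩, rfl⟩
    · exact Or.inl rfl
    · obtain ⟨c, rfl⟩ := IntermediateField.mem_bot.1 hc
      exact Or.inr ⟨c, rfl⟩

theorem spanPts_ratCurve_le {R V : Type*} [Field R] [AddCommGroup V] [Module R V] {d : ℕ}
    (e : Fin (d + 1) → V) : spanPts (ratCurve e : Set (ℙ R V)) ≤ Submodule.span R (Set.range e) := by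
  refine iSup₂_le fun P ⟨s, t, hP⟩ => ?_
  rw [hP.submodule_eq, Submodule.span_singleton_le_iff_mem]
  exact Submodule.sum_mem _ fun i _ => Submodule.smul_mem _ _ (Submodule.subset_span ⟨i, rfl⟩)

theorem notMem_bot_of_finrank {θ : K} (h : 2 ≤ Module.finrank F F⟮θ⟯) :
    θ ∉ (⊥ : IntermediateField F K) := by
  intro hθ
  rw [IntermediateField.adjoin_simple_eq_bot_iff.2 hθ, IntermediateField.finrank_bot] at h
  omega

theorem adjoin_neg (θ : K) : F⟮-θ⟯ = F⟮θ⟯ := by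
  apply le_antisymm
  · rw [adjoin_simple_le_iff]
    exact neg_mem (mem_adjoin_simple_self F θ)
  · rw [adjoin_simple_le_iff, ← neg_mem_iff]
    exact mem_adjoin_simple_self F _

variable [Fintype F] [Finite K]

/-- The point of the director space associated with the spread element of `w`. -/
theorem mk_mem_directorSpace {r : ℕ} (hr : r ∣ Module.finrank F K) {w : K × K} (hw : w ≠ 0)
    {Q : StarSpace F K}
    (hQ : IsCoord Q (fun j => if r ∣ j.val then frobPow F K j.val w.1 else 0,
      fun j => if r ∣ j.val then frobPow F K j.val w.2 else 0, 0))
    (hfix : (sigma F K)^[r] Q = Q) : Q ∈ directorSpace F K r := by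
  have hn : NeZero (Module.finrank F K) := ⟨Module.finrank_pos.ne'⟩
  have hr0 : 0 < r := Nat.pos_of_dvd_of_pos hr Module.finrank_pos
  refine ⟨?_, hfix⟩
  rw [hQ.submodule_eq, Submodule.span_singleton_le_iff_mem]
  have hv0 : ((Pi.single 0 w.1, Pi.single 0 w.2, 0) : StarVec F K) ≠ 0 := by
    intro h
    refine hw (Prod.ext ?_ ?_)
    · simpa using congrFun (congrArg Prod.fst h) 0
    · simpa using congrFun (congrArg (fun v => v.2.1) h) 0
  have hsum : ((fun j => if r ∣ j.val then frobPow F K j.val w.1 else 0,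
      fun j => if r ∣ j.val then frobPow F K j.val w.2 else 0, 0) : StarVec F K) =
      ∑ l ∈ Finset.range (Module.finrank F K / r),
        (sigmaVec F K)^[r * l] (Pi.single 0 w.1, Pi.single 0 w.2, 0) := by
    have key : ∀ (x : K) (j : ZMod (Module.finrank F K)),
        (if r ∣ j.val then frobPow F K j.val x else 0) =
        ∑ l ∈ Finset.range (Module.finrank F K / r),
          (Pi.single ((r * l : ℕ) : ZMod (Module.finrank F K)) (frobPow F K (r * l) x) :
            ZMod (Module.finrank F K) → K) j := by
      intro x j
      have hval : ∀ l < Module.finrank F K / r,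
          ((r * l : ℕ) : ZMod (Module.finrank F K)) = j → j.val = r * l := by
        intro l hl h
        rw [← h, ZMod.val_natCast, Nat.mod_eq_of_lt]
        calc r * l < r * (Module.finrank F K / r) := Nat.mul_lt_mul_of_pos_left hl hr0
          _ ≤ _ := Nat.mul_div_le _ _
      split_ifs with h
      · obtain ⟨l₀, hl₀⟩ := h
        have hlt : l₀ < Module.finrank F K / r := by
          rw [Nat.lt_div_iff_mul_lt' hr, ← hl₀]
          exact ZMod.val_lt j
        have hj : ((r * l₀ : ℕ) : ZMod (Module.finrank F K)) = j := by
          rw [← hl₀, ZMod.natCast_zmod_val]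
        rw [Finset.sum_eq_single l₀]
        · rw [hj, Pi.single_eq_same, hl₀]
        · intro l hl hne
          refine Pi.single_eq_of_ne (fun h => hne ?_) _
          have := hval l (Finset.mem_range.1 hl) h.symm
          exact Nat.eq_of_mul_eq_mul_left hr0 (this.symm.trans hl₀)
        · intro h
          exact absurd (Finset.mem_range.2 hlt) h
      · refine (Finset.sum_eq_zero fun l hl => ?_).symm
        refine Pi.single_eq_of_ne (fun h' => h ?_) _
        rw [hval l (Finset.mem_range.1 hl) h'.symm]
        exact dvd_mul_right _ _
    simp only [sigmaVec_iterate_single]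
    refine Prod.ext (funext fun j => ?_) (Prod.ext (funext fun j => ?_) ?_)
    · simp only [Prod.fst_sum, Finset.sum_apply]
      exact key _ _
    · simp only [Prod.fst_sum, Prod.snd_sum, Finset.sum_apply]
      exact key _ _
    · simp only [Prod.snd_sum, Finset.sum_const_zero]
  rw [hsum]
  refine Submodule.sum_mem _ fun l hl => ?_
  refine isCoord_mem_spanPts (Set.mem_biUnion (Finset.mem_range.1 hl)
    ⟨Projectivization.mk K _ hv0, ⟨w.1, w.2, isCoord_mk hv0⟩, rfl⟩)
    ((isCoord_mk hv0).sigma_iterate _)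

/-- Sublines over `F` are special curves. -/
theorem isSpecialCurve_lineSet {a w : K × K} {θ : K} (hw : w ≠ 0)
    (h2 : 2 ≤ Module.finrank F F⟮θ⟯) (hcard : Module.finrank F F⟮θ⟯ ≤ Fintype.card F) :
    IsSpecialCurve F K (Module.finrank F F⟮θ⟯)
      (affineSet F (lineSet ((⊥ : IntermediateField F K) : Set K) a w θ)) := by
  have hn : NeZero (Module.finrank F K) := ⟨Module.finrank_pos.ne'⟩
  have hθ := notMem_bot_of_finrank h2
  set η := -θ with hη
  have hηbot : η ∉ (⊥ : IntermediateField F K) := fun h => hθ (neg_mem_iff.1 h)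
  have hint : IsIntegral F η := IsIntegral.of_finite F η
  set r := Module.finrank F F⟮θ⟯ with hrdef
  have hrdvd : r ∣ Module.finrank F K := ⟨_, (Module.finrank_mul_finrank F F⟮θ⟯ K).symm⟩
  have hdeg : (minpoly F η).natDegree = r := by
    rw [← adjoin.finrank hint, hη, adjoin_neg]
  set f := minpoly F η with hf
  set g := minpolyDiv F η with hg
  have hfdeg : (f.map (algebraMap F K)).natDegree ≤ r := (natDegree_map_le).trans hdeg.le
  have hgdeg : g.natDegree ≤ r := (natDegree_minpolyDiv_lt hint).le.trans hdeg.le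
  have hAdeg : ∀ x y : K, (C x * f.map (algebraMap F K) + C y * g).natDegree ≤ r := fun x y =>
    natDegree_add_le_of_degree_le ((natDegree_C_mul_le _ _).trans hfdeg)
      ((natDegree_C_mul_le _ _).trans hgdeg)
  set e : Fin (r + 1) → K × K × F := fun i =>
    ((C a.1 * f.map (algebraMap F K) + C w.1 * g).coeff (r - i),
      (C a.2 * f.map (algebraMap F K) + C w.2 * g).coeff (r - i), f.coeff (r - i)) with he
  have hA := coordPoly_of_coeff (hAdeg a.1 w.1)
  have hB := coordPoly_of_coeff (hAdeg a.2 w.2)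
  have hD := coordPoly_of_coeff hdeg.le
  have hcurve : ratCurve e =
      affineSet F (lineSet ((⊥ : IntermediateField F K) : Set K) a w θ) := by
    have := ratCurve_eq_affineSet (e := e) (a := a) (w := w) (η := η) (δ := 1) one_ne_zero hηbot
      hdeg (by rw [map_one, C_1, one_mul]; exact hA) (by rw [map_one, C_1, one_mul]; exact hB)
      (by rw [C_1, one_mul]; exact hD)
    rw [this, hη, neg_neg]
  refine ⟨e, ?_, hcurve.symm, ?_⟩
  -- The curve already spans a space of vector dimension `r + 1`, so its `r + 1` coefficient vectors
  -- are independent.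
  · rw [linearIndependent_iff_card_le_finrank_span, Fintype.card_fin]
    have h1 := (spansOverSpread_lineSet (a := a) hw hθ bot_le hcard).1
    rw [← hcurve] at h1
    refine h1.symm.trans_le ?_
    exact Submodule.finrank_mono (spanPts_ratCurve_le e)
  · have hvec : ∀ c : K, curveVec e c =
        (fun j => aeval c f * frobPow F K j.val a.1 +
          eval₂ (frobPow F K j.val : K →+* K) c g * frobPow F K j.val w.1,
        fun j => aeval c f * frobPow F K j.val a.2 +
          eval₂ (frobPow F K j.val : K →+* K) c g * frobPow F K j.val w.2, aeval c f) := by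
      intro c
      have key : ∀ (x y : K) (m : ℕ),
          eval c ((C x * f.map (algebraMap F K) + C y * g).map (frobPow F K m : K →+* K)) =
          aeval c f * frobPow F K m x + eval₂ (frobPow F K m : K →+* K) c g * frobPow F K m y := by
        intro x y m
        rw [Polynomial.map_add, Polynomial.map_mul, Polynomial.map_mul, Polynomial.map_map, map_C, map_C,
          AlgHom.comp_algebraMap, eval_add, eval_mul, eval_mul, eval_C, eval_C,
          eval_map_algebraMap, eval_map]
        simp only [RingHom.coe_coe]
        ring
      rw [curveVec_eq]
      refine Prod.ext (funext fun j => ?_) (Prod.ext (funext fun j => ?_) ?_)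
      · refine Eq.trans ?_ (key a.1 w.1 j.val)
        exact congrArg (fun p => eval c (Polynomial.map _ p)) hA
      · refine Eq.trans ?_ (key a.2 w.2 j.val)
        exact congrArg (fun p => eval c (Polynomial.map _ p)) hB
      · exact congrArg (fun p => aeval c p) hD
    set κ := aeval η (derivative f) with hκdef
    have hκ : κ ≠ 0 :=
      (Algebra.IsSeparable.isSeparable F η).aeval_derivative_ne_zero (minpoly.aeval F η)
    -- The `j`-th conjugate of `g` is `f/(X - η^(q^j))`. At `η` it vanishes unless `η^(q^j) = η`,
    -- that is `r ∣ j`, when its value is `f'(η)`.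
    have hg2 : ∀ j : ZMod (Module.finrank F K),
        eval₂ (frobPow F K j.val : K →+* K) η g = if r ∣ j.val then κ else 0 := by
      classical
      intro j
      have h := eval₂_minpolyDiv_self η (frobPow F K j.val) (AlgHom.id F K)
      rw [AlgHom.id_apply, frobPow_eq_self_iff, ← hf, hdeg] at h
      refine h.trans ?_
      split_ifs with hd
      · rw [hκdef, ← aeval_algHom_apply, (frobPow_eq_self_iff η j.val).2 (by rwa [← hf, hdeg])]
      · rfl
    have hQ : curveVec e η = κ • ((fun j => if r ∣ j.val then frobPow F K j.val w.1 else 0,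
        fun j => if r ∣ j.val then frobPow F K j.val w.2 else 0, 0) : StarVec F K) := by
      rw [hvec]
      refine Prod.ext (funext fun j => ?_) (Prod.ext (funext fun j => ?_) ?_)
      · simp [hg2, hf, minpoly.aeval]
      · simp [hg2, hf, minpoly.aeval]
      · simp [hf, minpoly.aeval]
    have hq0 : ((fun j => if r ∣ j.val then frobPow F K j.val w.1 else 0,
        fun j => if r ∣ j.val then frobPow F K j.val w.2 else 0, 0) : StarVec F K) ≠ 0 := by
      intro h
      refine hw (Prod.ext ?_ ?_)
      · simpa [frobPow_zero] using congrFun (congrArg Prod.fst h) 0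
      · simpa [frobPow_zero] using congrFun (congrArg (fun v => v.2.1) h) 0
    set Q : StarSpace F K := Projectivization.mk K _ hq0 with hQdef
    have hQc : IsCoord Q (curveVec e η) := by
      rw [hQ, isCoord_smul_iff hκ]
      exact isCoord_mk hq0
    have hQm : ∀ m, IsCoord ((sigma F K)^[m] Q) (curveVec e (frobPow F K m η)) := fun m => by
      rw [← sigmaVec_iterate_curveVec]
      exact hQc.sigma_iterate m
    have hfix : (sigma F K)^[r] Q = Q := by
      have := hQm r
      rw [(frobPow_eq_self_iff η r).2 (by rw [← hf, hdeg])] at this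
      exact this.unique hQc
    have hdir := mk_mem_directorSpace hrdvd hw (isCoord_mk hq0) hfix
    refine ⟨Q, ?_, ?_⟩
    -- Different iterates are supported on different residue classes modulo `r`.
    · intro l hl l' hl' h
      simp only at h
      have h1 := sigma_iterate_le_suppSub hrdvd (directorSpace_le_suppSub hrdvd hdir) l (hQm l).mem
      have h2 := sigma_iterate_le_suppSub hrdvd (directorSpace_le_suppSub hrdvd hdir) l'
        (h ▸ (hQm l).mem)
      have h3 := suppSub_disjoint h1 h2 (hQm l).ne_zero
      rw [zero_add, zero_add, ZMod.natCast_eq_natCast_iff] at h3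
      exact Nat.ModEq.eq_of_lt_of_lt h3 hl hl'
    · ext P
      constructor
      · rintro ⟨hP, hPi⟩
        obtain ⟨i, -, hi⟩ := mem_indicatorPoints_le hrdvd hPi
        obtain hP | ⟨c, hP⟩ := mem_ratCurve_iff.1 hP
        · have h0 := (hi hP.mem).1
          refine absurd ?_ (one_ne_zero (α := K))
          rw [← h0]
          change 1 = algebraMap F K (f.coeff (r - (0 : Fin (r + 1)).val))
          rw [Fin.val_zero, Nat.sub_zero, ← hdeg, hf, (minpoly.monic hint).coeff_natDegree, map_one]
        · have h0 := (hi hP.mem).1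
          change (curveVec e c).2.2 = 0 at h0
          rw [hvec] at h0
          obtain ⟨m, hm, rfl⟩ := exists_frobPow_of_root h0
          exact ⟨m, hdeg ▸ hm, (hQm m).unique hP⟩
      · rintro ⟨m, hm, rfl⟩
        refine ⟨mem_ratCurve_iff.2 (Or.inr ⟨_, hQm m⟩), ?_⟩
        exact Set.mem_biUnion hm ⟨Q, hdir, rfl⟩

end ABB

/-! ### Special curves are sublines over `F` -/

namespace ABB

open IntermediateField Polynomial

variable {F K : Type*} [Field F] [Fintype F] [Field K] [Finite K] [Algebra F K]

/-- A polynomial of degree at most `[F(η) : F]` vanishing at the nontrivial conjugates of `η`. -/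
theorem exists_eq_combination {η : K} {A : K[X]} (hA : A.natDegree ≤ (minpoly F η).natDegree)
    (hroot : ∀ m < (minpoly F η).natDegree, m ≠ 0 → eval (frobPow F K m η) A = 0) :
    ∃ α β : K, A = C α * (minpoly F η).map (algebraMap F K) + C β * minpolyDiv F η := by
  have hint : IsIntegral F η := IsIntegral.of_finite F η
  set f := minpoly F η with hf
  set g := minpolyDiv F η with hg
  set r := f.natDegree with hr
  have hconj : ∀ m, aeval (frobPow F K m η) f = 0 := fun m => by
    rw [aeval_algHom_apply, hf, minpoly.aeval, map_zero]
  have hgη : eval η g ≠ 0 := by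
    rw [hg, eval_minpolyDiv_self]
    exact (Algebra.IsSeparable.isSeparable F η).aeval_derivative_ne_zero (minpoly.aeval F η)
  have hnat : ∀ x y : K, (C x * f.map (algebraMap F K) + C y * g).natDegree ≤ r := fun x y =>
    natDegree_add_le_of_degree_le ((natDegree_C_mul_le _ _).trans natDegree_map_le)
      ((natDegree_C_mul_le _ _).trans (natDegree_minpolyDiv_lt hint).le)
  -- The coefficients match degree `r` and the value at `η`. The difference has degree below `r` and
  -- vanishes at all `r` conjugates, since `g` vanishes at the nontrivial ones.
  refine ⟨A.coeff r, eval η A / eval η g, ?_⟩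
  rw [← sub_eq_zero]
  set h := A - (C (A.coeff r) * f.map (algebraMap F K) + C (eval η A / eval η g) * g) with hh
  have hcoeff : h.coeff r = 0 := by
    have h1 : f.coeff r = 1 := minpoly.monic hint
    have h2 : g.coeff r = 0 := coeff_eq_zero_of_natDegree_lt (natDegree_minpolyDiv_lt hint)
    simp [hh, h1, h2]
  have hdeg : h.natDegree < r := by
    have hr0 : 0 < r := minpoly.natDegree_pos hint
    refine lt_of_le_of_ne ((natDegree_sub_le _ _).trans (max_le hA (hnat _ _))) fun e => ?_
    rw [← e, coeff_natDegree, leadingCoeff_eq_zero] at hcoeff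
    rw [hcoeff, natDegree_zero] at e
    omega
  refine eq_zero_of_natDegree_lt_card_of_eval_eq_zero h
    (f := fun m : Fin r => frobPow F K m η) ?_ ?_ (by simpa using hdeg)
  · intro m m' e
    wlog hle : (m : ℕ) ≤ m' generalizing m m'
    · exact (this e.symm (le_of_not_ge hle)).symm
    have e' : frobPow F K m (frobPow F K (m' - m) η) = frobPow F K m η := by
      rw [frobPow_frobPow, Nat.sub_add_cancel hle]
      exact e.symm
    have e'' := (frobPow_eq_self_iff η _).1 ((frobPow F K m).toRingHom.injective e')
    have := Nat.eq_zero_of_dvd_of_lt e'' (lt_of_le_of_lt (Nat.sub_le _ _) m'.2)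
    exact Fin.ext (by omega)
  · intro m
    by_cases hm : (m : ℕ) = 0
    · simp only [hm, frobPow_zero, AlgHom.id_apply]
      have := hconj 0
      rw [frobPow_zero, AlgHom.id_apply] at this
      rw [hh, eval_sub, eval_add, eval_mul, eval_mul, eval_C, eval_C, eval_map_algebraMap, this,
        div_mul_cancel₀ _ hgη]
      ring
    · have hne : frobPow F K m η ≠ η := fun e => by
        have := Nat.eq_zero_of_dvd_of_lt ((frobPow_eq_self_iff η _).1 e) m.2
        exact hm this
      rw [hh, eval_sub, eval_add, eval_mul, eval_mul, eval_map_algebraMap, hconj,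
        hroot m m.2 hm, hg, minpolyDiv_eval_eq_zero_of_ne_of_aeval_eq_zero hne (hconj m)]
      ring

/-- A special curve of degree at least two through two affine points is a subline over `F`. -/
theorem IsSpecialCurve.exists_lineSet {r : ℕ} (hr : r ∣ Module.finrank F K) (h2 : 2 ≤ r)
    {S : Set (Space F K)} (hS : IsSpecialCurve F K r S) {p p' : K × K} (hp : affinePt F p ∈ S)
    (hp' : affinePt F p' ∈ S) (hne : p ≠ p') :
    ∃ (a w : K × K) (θ : K), w ≠ 0 ∧ Module.finrank F F⟮θ⟯ = r ∧
      S = affineSet F (lineSet ((⊥ : IntermediateField F K) : Set K) a w θ) := by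
  obtain ⟨e, -, rfl, Q, hinj, hQ⟩ := hS
  have hQmem : Q ∈ ratCurve (fun i => emb F K (e i)) ∩ indicatorPoints F K r := by
    rw [hQ]
    exact ⟨0, by simp; omega, rfl⟩
  obtain ⟨i, hir, hi⟩ := mem_indicatorPoints_le hr hQmem.2
  obtain h | ⟨c, hc⟩ := mem_ratCurve_iff.1 hQmem.1
  -- At parameter `∞` the point is `F`-rational, hence fixed by `σ`, contrary to having `r ≥ 2`
  -- distinct conjugates.
  · have hfix : (sigma F K)^[1] Q = (sigma F K)^[0] Q := by
      have := h.sigma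
      rw [sigmaVec_emb] at this
      exact this.unique h
    exact absurd (hinj (by simp; omega) (by simp; omega) hfix) one_ne_zero
  have hc : IsCoord Q (curveVec e c) := hc
  -- Applying `σ^(r-i)` moves the support of `Q` from the class of `i` to the class of `0`.
  set η := frobPow F K (r - i) c with hη
  set A := coordPoly (fun i => (e i).1) with hA
  set B := coordPoly (fun i => (e i).2.1) with hB
  set D := coordPoly (fun i => (e i).2.2) with hD
  have hsupp : ∀ m : ℕ, curveVec e (frobPow F K m η) ∈ suppSub F K r m ∧
      curveVec e (frobPow F K m η) ≠ 0 := by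
    intro m
    have h := hc.sigma_iterate (r - i + m)
    rw [sigmaVec_iterate_curveVec, ← frobPow_frobPow] at h
    refine ⟨?_, h.ne_zero⟩
    have := sigma_iterate_le_suppSub hr hi (r - i + m) h.mem
    rwa [← Nat.cast_add, show i + (r - i + m) = r + m by omega, Nat.cast_add, ZMod.natCast_self,
      zero_add] at this
  -- Index `0` carries the unconjugated `A` and `B`, and lies outside the support of the `m`-th
  -- conjugate point unless `r ∣ m`.
  have hAev : ∀ m : ℕ, (m : ZMod r) ≠ 0 → eval (frobPow F K m η) A = 0 ∧
      eval (frobPow F K m η) B = 0 := by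
    intro m hm
    have := (hsupp m).1.2 0 (by simpa using hm.symm)
    rw [curveVec_eq] at this
    simpa [frobPow_zero, hA, hB, map_coordPoly, eval_coordPoly] using this
  have hDev : aeval η D = 0 := by
    have := (hsupp 0).1.1
    rwa [curveVec_eq, frobPow_zero, AlgHom.id_apply] at this
  have hmod : ∀ m, frobPow F K m η = η → r ∣ m := by
    intro m hm
    have h0 := (hsupp 0).1
    have h1 := (hsupp m).1
    rw [hm] at h1
    rw [frobPow_zero, AlgHom.id_apply] at h0
    have := suppSub_disjoint h1 h0 (hm ▸ (hsupp m).2)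
    rwa [Nat.cast_zero, ZMod.natCast_eq_zero_iff] at this
  have hint : IsIntegral F η := IsIntegral.of_finite F η
  have hD0 : D ≠ 0 := by
    intro h0
    have he : ∀ i, (e i).2.2 = 0 := fun i => by
      have := coordPoly_coeff (fun i => (e i).2.2) i
      rw [← this, ← hD, h0, coeff_zero]
    obtain ⟨s, t, hst⟩ := hp
    refine affinePt_not_le p (hst.le_infinity.2 ?_)
    simp [Prod.snd_sum, he]
  have hdvd : minpoly F η ∣ D := minpoly.dvd F η hDev
  have hDdeg : D.natDegree ≤ r := natDegree_coordPoly_le _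
  -- The degree is at most `deg D ≤ r`; it is a multiple of `r` because the Frobenius power of that
  -- exponent fixes `η`.
  have hdeg : (minpoly F η).natDegree = r :=
    le_antisymm ((natDegree_le_of_dvd hdvd hD0).trans hDdeg)
      (Nat.le_of_dvd (minpoly.natDegree_pos hint) (hmod _ ((frobPow_eq_self_iff η _).2 dvd_rfl)))
  obtain ⟨δ, hδ, hDeq⟩ : ∃ δ : F, δ ≠ 0 ∧ D = C δ * minpoly F η := by
    refine ⟨D.leadingCoeff, leadingCoeff_ne_zero.2 hD0, ?_⟩
    exact (eq_leadingCoeff_mul_of_monic_of_dvd_of_natDegree_le (minpoly.monic hint) hdvd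
      (hDdeg.trans hdeg.ge))
  have hcast : ∀ m < (minpoly F η).natDegree, m ≠ 0 → (m : ZMod r) ≠ 0 := by
    intro m hm h0 h
    rw [ZMod.natCast_eq_zero_iff] at h
    exact h0 (Nat.eq_zero_of_dvd_of_lt h (hdeg ▸ hm))
  obtain ⟨α₁, β₁, h₁⟩ := exists_eq_combination (η := η) (A := A)
    ((natDegree_coordPoly_le _).trans hdeg.ge) fun m hm h0 => (hAev m (hcast m hm h0)).1
  obtain ⟨α₂, β₂, h₂⟩ := exists_eq_combination (η := η) (A := B)
    ((natDegree_coordPoly_le _).trans hdeg.ge) fun m hm h0 => (hAev m (hcast m hm h0)).2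
  have hηbot : η ∉ (⊥ : IntermediateField F K) := by
    intro h
    obtain ⟨x, hx⟩ := IntermediateField.mem_bot.1 h
    have := Nat.le_of_dvd one_pos (hmod 1 (by rw [← hx, AlgHom.commutes]))
    omega
  set δ' := algebraMap F K δ with hδ'
  have hδ0 : δ' ≠ 0 := by simpa [hδ'] using hδ
  have hscale : ∀ α β : K, C α * (minpoly F η).map (algebraMap F K) + C β * minpolyDiv F η =
      C δ' * (C (δ'⁻¹ * α) * (minpoly F η).map (algebraMap F K) +
        C (δ'⁻¹ * β) * minpolyDiv F η) := by
    intro α β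
    rw [mul_add, ← mul_assoc, ← mul_assoc, ← C_mul, ← C_mul, mul_inv_cancel_left₀ hδ0,
      mul_inv_cancel_left₀ hδ0]
  have hcurve := ratCurve_eq_affineSet (e := e) (a := (δ'⁻¹ * α₁, δ'⁻¹ * α₂))
    (w := (δ'⁻¹ * β₁, δ'⁻¹ * β₂)) hδ hηbot hdeg (h₁.trans (hscale _ _)) (h₂.trans (hscale _ _)) hDeq
  refine ⟨_, _, -η, ?_, ?_, hcurve⟩
  · intro hw
    have hpt : ∀ p, affinePt F p ∈ ratCurve e → p = (δ'⁻¹ * α₁, δ'⁻¹ * α₂) := by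
      intro p hp
      rw [hcurve, affinePt_mem_affineSet, hw] at hp
      obtain hp | ⟨c, -, hp⟩ := hp
      · exact hp
      · simpa using hp.symm
    exact hne ((hpt p hp).trans (hpt p' hp').symm)
  · rw [adjoin_neg, adjoin.finrank hint, hdeg]

/-- A special curve of degree one has a point at infinity. -/
theorem IsSpecialCurve.exists_le_infinity {S : Set (Space F K)} (hS : IsSpecialCurve F K 1 S) :
    ∃ P ∈ S, P.submodule ≤ infinity F K := by
  obtain ⟨e, hli, rfl, -⟩ := hS
  rw [Fintype.linearIndependent_iff] at hli
  obtain ⟨s, t, hst, h0⟩ : ∃ s t : F, (s, t) ≠ (0, 0) ∧ s * (e 0).2.2 + t * (e 1).2.2 = 0 := by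
    by_cases h : (e 0).2.2 = 0
    · exact ⟨1, 0, by simp, by simp [h]⟩
    · exact ⟨-(e 1).2.2, (e 0).2.2, by simp [h], by ring⟩
  have hv : s • e 0 + t • e 1 ≠ 0 := by
    intro h
    have := hli ![s, t] (by simpa [Fin.sum_univ_two] using h)
    exact hst (Prod.ext (by simpa using this 0) (by simpa using this 1))
  refine ⟨Projectivization.mk F _ hv, ⟨s, t, ?_⟩, (isCoord_mk hv).le_infinity.2 ?_⟩
  · convert isCoord_mk (R := F) hv using 1
    simp [Fin.sum_univ_two]
  · simpa using h0

end ABB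

/-! ### Sets closed under sublines over `F` -/

namespace ABB

open IntermediateField

variable (F : Type*) {K : Type*} [Field F] [Field K] [Algebra F K]

/-- Every three distinct points of `T` lie on an affine subline over `F` which is contained in `T`
and whose parameter has degree `r`. -/
def SublineClosed (r : ℕ) (T : Set (K × K)) : Prop :=
  ∀ p₁ ∈ T, ∀ p₂ ∈ T, ∀ p₃ ∈ T, p₁ ≠ p₂ → p₁ ≠ p₃ → p₂ ≠ p₃ → ∃ (w : K × K) (θ : K), w ≠ 0 ∧
    θ ∉ (⊥ : IntermediateField F K) ∧ Module.finrank F F⟮θ⟯ = r ∧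
    lineSet ((⊥ : IntermediateField F K) : Set K) p₁ w θ ⊆ T ∧
    p₂ = p₁ + θ⁻¹ • w ∧ p₃ = p₁ + (1 + θ)⁻¹ • w

/-- `S` contains the affine `F`-line through any two of its points. -/
def LineClosed (S : Set K) : Prop :=
  ∀ c ∈ S, ∀ d ∈ S, c ≠ d → ∀ x : F, c + algebraMap F K x * (d - c) ∈ S

variable {F}

/-- On the `F`-subline through the base point and the points with parameters `c`, `d`, the point
with normal parameter `x` has parameter `c + x(d - c)` in `S`. -/
theorem SublineClosed.lineClosed {r : ℕ} {S : Set K} {a w : K × K} {θ : K} (hw : w ≠ 0)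
    (hS : ∀ d ∈ S, d + θ ≠ 0) (h : SublineClosed F r (lineSet S a w θ)) : LineClosed F S := by
  intro c hc d hd hcd x
  have hne : ∀ {y : K} {v : K × K}, y ≠ 0 → v ≠ 0 → a ≠ a + y⁻¹ • v := fun hy hv e =>
    smul_ne_zero (inv_ne_zero hy) hv (by simpa using e.symm)
  obtain ⟨w₁, θ₁, hw₁, hθ₁, -, hsub, e₂, e₃⟩ := h a base_mem_lineSet _ (mem_lineSet hc) _
    (mem_lineSet hd) (hne (hS c hc) hw) (hne (hS d hd) hw) fun e => hcd (lineSet_inj hw e)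
  have h0 : θ₁ ≠ 0 := fun e => hθ₁ (e ▸ zero_mem _)
  have h1 : 1 + θ₁ ≠ 0 := add_ne_zero_of_notMem hθ₁ (one_mem _)
  have hx : algebraMap F K x + θ₁ ≠ 0 :=
    add_ne_zero_of_notMem hθ₁ (IntermediateField.algebraMap_mem _ _)
  have hc0 := hS c hc
  have hd0 := hS d hd
  have f₂ : w₁ = (θ₁ * (c + θ)⁻¹) • w := by
    rw [mul_smul, add_left_cancel e₂, smul_smul, mul_inv_cancel₀ h0, one_smul]
  have f₃ : w₁ = ((1 + θ₁) * (d + θ)⁻¹) • w := by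
    rw [mul_smul, add_left_cancel e₃, smul_smul, mul_inv_cancel₀ h1, one_smul]
  have f : θ₁ * (c + θ)⁻¹ = (1 + θ₁) * (d + θ)⁻¹ := smul_left_injective K hw (f₂.symm.trans f₃)
  have f' : θ₁ * (d - c) = c + θ := by
    field_simp at f
    linear_combination f
  obtain e | ⟨y, hy, e⟩ := hsub (mem_lineSet (IntermediateField.algebraMap_mem _ x))
  · exact absurd e.symm (hne hx hw₁)
  · have hy0 := hS y hy
    have e' := add_left_cancel e
    rw [f₂, smul_smul] at e'
    have e'' : (y + θ)⁻¹ = (algebraMap F K x + θ₁)⁻¹ * (θ₁ * (c + θ)⁻¹) :=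
      smul_left_injective K hw e'
    have : y = c + algebraMap F K x * (d - c) := by
      field_simp at e''
      refine mul_left_cancel₀ h0 ?_
      linear_combination -e'' - algebraMap F K x * f'
    exact this ▸ hy

/-- Two fixed points determine the line: each further point lies on an `F`-subline with them, hence
on the line through `p₁` with direction `w`. -/
theorem SublineClosed.exists_lineSet {r : ℕ} {T : Set (K × K)} (h : SublineClosed F r T)
    (hT : 2 < T.ncard) : ∃ (S : Set K) (a w : K × K) (θ : K), w ≠ 0 ∧
      Module.finrank F F⟮θ⟯ = r ∧ T = lineSet S a w θ ∧ (∀ d ∈ S, d + θ ≠ 0) ∧ 0 ∈ S ∧ 1 ∈ S := by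
  obtain ⟨p₁, p₂, p₃, h₁, h₂, h₃, h₁₂, h₁₃, h₂₃⟩ :=
    (Set.two_lt_ncard_iff (Set.finite_of_ncard_pos (by omega))).1 hT
  obtain ⟨w, θ, hw, hθ, hr, hsub, e₂, e₃⟩ := h p₁ h₁ p₂ h₂ p₃ h₃ h₁₂ h₁₃ h₂₃
  have hθ0 : θ ≠ 0 := fun e => hθ (e ▸ zero_mem _)
  have hθ1 : 1 + θ ≠ 0 := add_ne_zero_of_notMem hθ (one_mem _)
  -- Excluding `c = -θ` is needed: with `0⁻¹ = 0` it would yield the base point again.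
  refine ⟨{c | c + θ ≠ 0 ∧ p₁ + (c + θ)⁻¹ • w ∈ T}, p₁, w, θ, hw, hr, ?_, fun d hd => hd.1,
    ⟨by rwa [zero_add], by rwa [zero_add, ← e₂]⟩, ⟨hθ1, by rwa [← e₃]⟩⟩
  apply Set.Subset.antisymm
  · intro p hp
    by_cases hp₁ : p₁ = p
    · exact hp₁ ▸ base_mem_lineSet
    by_cases hp₂ : p₂ = p
    · rw [← hp₂, e₂]
      refine Set.mem_insert_of_mem _ ⟨0, ⟨by rwa [zero_add], by rwa [zero_add, ← e₂]⟩, ?_⟩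
      simp
    obtain ⟨w₁, θ₁, hw₁, hθ₁, -, hsub₁, f₂, f₃⟩ := h p₁ h₁ p₂ h₂ p hp h₁₂ hp₁ hp₂
    have h0 : θ₁ ≠ 0 := fun e => hθ₁ (e ▸ zero_mem _)
    have h1 : 1 + θ₁ ≠ 0 := add_ne_zero_of_notMem hθ₁ (one_mem _)
    have hw₁' : w₁ = (θ₁ * θ⁻¹) • w := by
      rw [mul_smul, add_left_cancel (e₂.symm.trans f₂), smul_smul, mul_inv_cancel₀ h0, one_smul]
    have hsum : θ / θ₁ + θ = (1 + θ₁) * θ / θ₁ := by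
      field_simp
    have hpc : p = p₁ + (θ / θ₁ + θ)⁻¹ • w := by
      rw [f₃, hw₁', smul_smul, hsum]
      congr 2
      field_simp
    rw [hpc] at hp ⊢
    refine mem_lineSet ⟨?_, hp⟩
    rw [hsum]
    exact div_ne_zero (mul_ne_zero h1 hθ0) h0
  · rintro p (rfl | ⟨c, hc, rfl⟩)
    · exact h₁
    · exact hc.2

theorem LineClosed.smul_mem {S : Set K} (h : LineClosed F S) (h0 : (0 : K) ∈ S) (x : F) {d : K}
    (hd : d ∈ S) : algebraMap F K x * d ∈ S := by
  by_cases hd0 : 0 = d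
  · rwa [← hd0, mul_zero]
  · simpa using h 0 h0 d hd hd0 x

/-- `c + d` is the point with parameter `y` on the line from `c/(1 - y)` to `d/y`. If these
coincide, it is the multiple `d/y`. -/
theorem LineClosed.add_mem {S : Set K} (h : LineClosed F S) (h0 : (0 : K) ∈ S) {y : F}
    (hy0 : y ≠ 0) (hy1 : y ≠ 1) {c d : K} (hc : c ∈ S) (hd : d ∈ S) : c + d ∈ S := by
  have hy1' : 1 - y ≠ 0 := sub_ne_zero.2 hy1.symm
  have hc' := h.smul_mem h0 (1 - y)⁻¹ hc
  have hd' := h.smul_mem h0 y⁻¹ hd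
  have hz : algebraMap F K y ≠ 0 := by simpa using hy0
  have hz' : 1 - algebraMap F K y ≠ 0 := by
    rw [← map_one (algebraMap F K), ← map_sub]
    exact (map_ne_zero _).2 hy1'
  by_cases e : algebraMap F K (1 - y)⁻¹ * c = algebraMap F K y⁻¹ * d
  · rw [map_inv₀, map_inv₀, map_sub, map_one] at e
    have : c + d = algebraMap F K (y⁻¹) * d := by
      rw [map_inv₀]
      field_simp at e ⊢
      linear_combination e
    rw [this]
    exact hd'
  · have := h _ hc' _ hd' e y
    convert this using 1
    simp only [map_inv₀, map_sub, map_one]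
    field_simp
    ring

/-- A set containing `0` and `1` which is closed under `F`-lines, and whose set of negative inverses
is closed under `F`-lines, is a subfield. -/
theorem exists_intermediateField [Fintype F] [Finite K] (hq : 2 < Fintype.card F) {S : Set K}
    (h0 : (0 : K) ∈ S) (h1 : (1 : K) ∈ S) (h : LineClosed F S)
    (h' : LineClosed F ((fun d => (0 - d)⁻¹) '' S)) :
    ∃ E : IntermediateField F K, (E : Set K) = S := by
  classical
  obtain ⟨y, hy0, hy1⟩ : ∃ y : F, y ≠ 0 ∧ y ≠ 1 := by
    obtain ⟨y, hy⟩ := Finset.exists_mem_notMem_of_card_lt_card (s := {0, 1})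
      (t := (Finset.univ : Finset F)) (Finset.card_le_two.trans_lt hq)
    exact ⟨y, by simpa using hy.2⟩
  have h0' : (0 : K) ∈ (fun d => (0 - d)⁻¹) '' S := ⟨0, h0, by simp⟩
  have hadd : ∀ {c d : K}, c ∈ S → d ∈ S → c + d ∈ S := h.add_mem h0 hy0 hy1
  have hneg : ∀ {c : K}, c ∈ S → -c ∈ S := fun hc => by
    simpa using h.smul_mem h0 (-1) hc
  have hsub : ∀ {c d : K}, c ∈ S → d ∈ S → c - d ∈ S := fun hc hd => by
    rw [sub_eq_add_neg]
    exact hadd hc (hneg hd)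
  have hmem' : ∀ {c : K}, c ∈ S → c⁻¹ ∈ (fun d => (0 - d)⁻¹) '' S := fun {c} hc =>
    ⟨-c, hneg hc, by simp⟩
  have hmem : ∀ {c : K}, c ∈ (fun d => (0 - d)⁻¹) '' S → c⁻¹ ∈ S := by
    rintro _ ⟨d, hd, rfl⟩
    simpa using hneg hd
  have hharm : ∀ {c d : K}, c ∈ S → d ∈ S → (c⁻¹ + d⁻¹)⁻¹ ∈ S := fun hc hd =>
    hmem (h'.add_mem h0' hy0 hy1 (hmem' hc) (hmem' hd))
  -- Hua's identity: `c - (c⁻¹ + (d - c)⁻¹)⁻¹ = c²/d`.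
  have hsqdiv : ∀ {c d : K}, c ∈ S → d ∈ S → c ^ 2 * d⁻¹ ∈ S := by
    intro c d hc hd
    by_cases hc0 : c = 0
    · simpa [hc0] using h0
    by_cases hd0 : d = 0
    · simpa [hd0] using h0
    by_cases hcd : d - c = 0
    · rw [sub_eq_zero] at hcd
      subst hcd
      rwa [pow_two, mul_inv_cancel_right₀ hd0]
    have := hsub hc (hharm hc (hsub hd hc))
    convert this using 1
    have e : c⁻¹ + (d - c)⁻¹ = d * (c * (d - c))⁻¹ := by
      field_simp
      ring
    rw [e, mul_inv, inv_inv]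
    field_simp
    ring
  have hinv : ∀ {c : K}, c ∈ S → c⁻¹ ∈ S := fun hc => by simpa using hsqdiv h1 hc
  have hsqmul : ∀ {c d : K}, c ∈ S → d ∈ S → c ^ 2 * d ∈ S := fun hc hd => by
    simpa using hsqdiv hc (hinv hd)
  have hmul : ∀ {c d : K}, c ∈ S → d ∈ S → c * d ∈ S := by
    intro c d hc hd
    -- In characteristic two, squaring is injective on the finite set `S`, so `c` is a square `b²`.
    -- Otherwise `(c + 1)²d - c²d - d = 2cd`.
    by_cases htwo : (2 : F) = 0
    · have htwo' : (2 : K) = 0 := by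
        rw [← map_ofNat (algebraMap F K) 2, htwo, map_zero]
      have hinj : Function.Injective fun x : S => (⟨x.1 ^ 2, by
          simpa using hsqmul x.2 h1⟩ : S) := by
        rintro ⟨x, hx⟩ ⟨z, hz⟩ e
        have e' : x ^ 2 = z ^ 2 := congrArg Subtype.val e
        have : (x - z) ^ 2 = 0 := by linear_combination e' + (z ^ 2 - x * z) * htwo'
        exact Subtype.ext (sub_eq_zero.1 (pow_eq_zero_iff two_ne_zero |>.1 this))
      obtain ⟨b, hb⟩ := Finite.surjective_of_injective hinj ⟨c, hc⟩
      have hb' : b.1 ^ 2 = c := congrArg Subtype.val hb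
      rw [← hb']
      exact hsqmul b.2 hd
    · have := h.smul_mem h0 2⁻¹ (hsub (hsub (hsqmul (hadd hc h1) hd) (hsqmul hc hd)) hd)
      convert this using 1
      have htwo' : (2 : K) ≠ 0 := by
        rw [← map_ofNat (algebraMap F K) 2]
        exact (map_ne_zero _).2 htwo
      rw [map_inv₀, map_ofNat]
      field_simp
      ring
  exact ⟨{ carrier := S
           mul_mem' := hmul
           add_mem' := hadd
           algebraMap_mem' := fun x => by simpa using h.smul_mem h0 x h1
           inv_mem' := fun x => hinv }, rfl⟩

/-- A set closed under `F`-sublines is a subline. -/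
theorem SublineClosed.exists_subline [Fintype F] [Finite K] (hq : 2 < Fintype.card F) {r k : ℕ}
    {T : Set (K × K)} (h : SublineClosed F r T) (hcard : T.ncard = Fintype.card F ^ k + 1)
    (hT : 2 < T.ncard) : ∃ (E : IntermediateField F K) (a w : K × K) (θ : K),
      Module.finrank F E = k ∧ w ≠ 0 ∧ θ ∉ E ∧ Module.finrank F F⟮θ⟯ = r ∧
        T = lineSet (E : Set K) a w θ := by
  obtain ⟨S, a, w, θ, hw, hr, rfl, hS, h0, h1⟩ := h.exists_lineSet hT
  have hrebase := lineSet_rebase a w hS h0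
  have hθ0 := hS 0 h0
  -- Rebasing at the parameter `0` replaces `S` by its negative inverses, and line-closure applies
  -- at the new base point.
  have hline' : LineClosed F ((fun d => (0 - d)⁻¹) '' S) := by
    have h2 := h
    rw [hrebase] at h2
    refine h2.lineClosed (smul_ne_zero (inv_ne_zero (pow_ne_zero 2 hθ0)) hw) ?_
    rintro _ ⟨d, hd, rfl⟩ e
    have e1 : (0 - d)⁻¹ = (0 + θ)⁻¹ := by linear_combination e
    have e2 := inv_injective e1
    exact hS d hd (by linear_combination -e2)
  obtain ⟨E, rfl⟩ := exists_intermediateField hq h0 h1 (h.lineClosed hw hS) hline'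
  have hθ : θ ∉ E := fun hθ => hS (-θ) (neg_mem hθ) (neg_add_cancel θ)
  refine ⟨E, a, w, θ, ?_, hw, hθ, hr, rfl⟩
  rw [lineSet, Set.ncard_insert_of_notMem, Set.ncard_image_of_injective] at hcard
  · have h2 : Nat.card E = Fintype.card F ^ k := by
      rw [← Nat.add_right_cancel hcard]
      rfl
    rw [Module.natCard_eq_pow_finrank (K := F), Nat.card_eq_fintype_card] at h2
    exact Nat.pow_right_injective (by omega) h2
  · exact fun c d e => lineSet_inj hw e
  · rintro ⟨c, hc, e⟩
    have : (c + θ)⁻¹ • w = 0 := by simpa using e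
    exact smul_ne_zero (inv_ne_zero (hS c hc)) hw this

end ABB

end

/-! ### The characterisation -/

open ABB IntermediateField in
theorem corollary2p9 (F K : Type*) [Field F] [Fintype F] [Field K] [Finite K] [Algebra F K]
    (q n k r : ℕ) (hq : Fintype.card F = q) (hn : Module.finrank F K = n)
    (hnpp : IsPrimePow n) (hqn : n ≤ q) (hn2 : 2 < n) (hk : k ∣ n) (hr : r ∣ n)
    (M : Set (ABB.Space F K)) (hMcard : M.ncard = q ^ k + 1)
    (hMaff : ∀ P ∈ M, ¬ P.submodule ≤ ABB.infinity F K) :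
    (∃ m : Set (ABB.Plane K), ABB.IsSubline F K k m ∧ ABB.IsExternal m ∧
        ABB.SmallestTangentDegree F K m r ∧ M = ABB.abbImage F K m) ↔
      ABB.SpansOverSpread F K r M ∧ ABB.CurveClosed F K r M := by
  subst hq hn
  have hrq : r ≤ Fintype.card F := (Nat.le_of_dvd (by omega) hr).trans hqn
  constructor
  · rintro ⟨m, hm, hext, hst, rfl⟩
    obtain ⟨E, a, w, θ, hE, hw, hθ, rfl⟩ := exists_eq_lineSet hm hext
    have hEθ := le_adjoin_of_notMem hnpp hθ
    rw [smallestTangentDegree_lineSet_iff hw hθ hEθ] at hst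
    subst hst
    rw [abbImage_affineSet]
    refine ⟨spansOverSpread_lineSet hw hθ hEθ hrq, ?_⟩
    have h2 : 2 ≤ Module.finrank F F⟮θ⟯ := by
      have h0 : 0 < Module.finrank F F⟮θ⟯ := Module.finrank_pos
      have h1 : Module.finrank F F⟮θ⟯ ≠ 1 := fun h1 => by
        rw [IntermediateField.finrank_eq_one_iff, adjoin_simple_eq_bot_iff] at h1
        exact hθ (bot_le (a := E) h1)
      omega
    intro A hA B hB D hD hAB hAD hBD
    rw [affineSet_eq_image] at hA hB hD
    obtain ⟨p₁, h₁, rfl⟩ := hA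
    obtain ⟨p₂, h₂, rfl⟩ := hB
    obtain ⟨p₃, h₃, rfl⟩ := hD
    have h₁₂ : p₁ ≠ p₂ := fun h => hAB (h ▸ rfl)
    have h₁₃ : p₁ ≠ p₃ := fun h => hAD (h ▸ rfl)
    have h₂₃ : p₂ ≠ p₃ := fun h => hBD (h ▸ rfl)
    -- In normal position the three points have parameters `∞`, `1·0`, `1`, so they lie on the
    -- `F`-subline inside the `E`-subline, with the same field `F(θ') = F(θ)`.
    obtain ⟨w', θ', e, hw', hmob, e₂, e₃⟩ := exists_lineSet_normal hw hθ h₁ h₂ h₃ h₁₂ h₁₃ h₂₃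
    have hadj := adjoin_eq_of_mobius hnpp hθ hmob
    have hθ' : θ' ∉ (⊥ : IntermediateField F K) := fun h =>
      (hmob E le_rfl).not.1 hθ (bot_le (a := E) h)
    have m₁ : p₁ ∈ lineSet ((⊥ : IntermediateField F K) : Set K) p₁ w' θ' := base_mem_lineSet
    have m₂ : p₂ ∈ lineSet ((⊥ : IntermediateField F K) : Set K) p₁ w' θ' := by
      rw [e₂, ← zero_add θ', ← zero_add θ']
      convert mem_lineSet (zero_mem (⊥ : IntermediateField F K)) using 3
      simp
    have m₃ : p₃ ∈ lineSet ((⊥ : IntermediateField F K) : Set K) p₁ w' θ' := by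
      rw [e₃]
      exact mem_lineSet (one_mem (⊥ : IntermediateField F K))
    refine ⟨affineSet F (lineSet ((⊥ : IntermediateField F K) : Set K) p₁ w' θ'), ⟨?_, ?_⟩, ?_, ?_⟩
    · rw [hadj] at h2 hrq ⊢
      exact isSpecialCurve_lineSet hw' h2 hrq
    · simp [Set.insert_subset_iff, m₁, m₂, m₃]
    · rw [e, affineSet_subset]
      exact lineSet_mono (fun x hx => bot_le (a := E) hx) _ _ _
    · rintro C' ⟨hC', hsub⟩
      simp only [Set.insert_subset_iff, Set.singleton_subset_iff] at hsub
      obtain ⟨a₁, w₁, θ₁, hw₁, hdeg, rfl⟩ :=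
        hC'.exists_lineSet hr h2 hsub.1 hsub.2.1 h₁₂
      simp only [affinePt_mem_affineSet] at hsub
      rw [lineSet_eq_of_common hw₁ hw' (notMem_bot_of_finrank (hdeg ▸ h2)) hθ'
        hsub.1 hsub.2.1 hsub.2.2 m₁ m₂ m₃ h₁₂ h₁₃ h₂₃]
  · rintro ⟨-, hclosed⟩
    obtain ⟨T, rfl⟩ := exists_affineSet hMaff
    rw [ncard_affineSet] at hMcard
    have hcard2 : 2 < T.ncard := by
      have hk0 : k ≠ 0 := by
        rintro rfl
        rw [zero_dvd_iff] at hk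
        omega
      have := Nat.le_self_pow hk0 (Fintype.card F)
      omega
    have hr0 : 0 < r := Nat.pos_of_dvd_of_pos hr (by omega)
    -- A special curve of degree one is a full line and would put a point of `M` on `H_∞`.
    have hr2 : 2 ≤ r := by
      by_contra hlt
      obtain rfl : r = 1 := by omega
      obtain ⟨p₁, p₂, p₃, h₁, h₂, h₃, h₁₂, h₁₃, h₂₃⟩ :=
        (Set.two_lt_ncard_iff (Set.finite_of_ncard_pos (by omega))).1 hcard2
      obtain ⟨C, ⟨hC, -⟩, hCM, -⟩ := hclosed _ (affinePt_mem_affineSet.2 h₁) _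
        (affinePt_mem_affineSet.2 h₂) _ (affinePt_mem_affineSet.2 h₃) (affinePt_injective.ne h₁₂)
        (affinePt_injective.ne h₁₃) (affinePt_injective.ne h₂₃)
      obtain ⟨P, hP, hinf⟩ := hC.exists_le_infinity
      exact hMaff P (hCM hP) hinf
    have hsc : SublineClosed F r T := by
      intro p₁ h₁ p₂ h₂ p₃ h₃ h₁₂ h₁₃ h₂₃
      obtain ⟨C, ⟨hC, hsub⟩, hCM, -⟩ := hclosed _ (affinePt_mem_affineSet.2 h₁) _
        (affinePt_mem_affineSet.2 h₂) _ (affinePt_mem_affineSet.2 h₃) (affinePt_injective.ne h₁₂)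
        (affinePt_injective.ne h₁₃) (affinePt_injective.ne h₂₃)
      simp only [Set.insert_subset_iff, Set.singleton_subset_iff] at hsub
      obtain ⟨a, w, θ, hw, hdeg, rfl⟩ := hC.exists_lineSet hr hr2 hsub.1 hsub.2.1 h₁₂
      simp only [affinePt_mem_affineSet] at hsub
      have hθ : θ ∉ (⊥ : IntermediateField F K) := notMem_bot_of_finrank (hdeg ▸ hr2)
      obtain ⟨w', θ', e, hw', hmob, e₂, e₃⟩ :=
        exists_lineSet_normal hw hθ hsub.1 hsub.2.1 hsub.2.2 h₁₂ h₁₃ h₂₃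
      refine ⟨w', θ', hw', (hmob ⊥ le_rfl).not.1 hθ, ?_, ?_, e₂, e₃⟩
      · rw [← adjoin_eq_of_mobius hnpp hθ hmob, hdeg]
      · rw [← e]
        exact affineSet_subset.1 hCM
    obtain ⟨E, a, w, θ, hE, hw, hθ, hdeg, rfl⟩ :=
      hsc.exists_subline (by omega) hMcard hcard2
    refine ⟨affineSet K (lineSet (E : Set K) a w θ), hE ▸ isSubline_lineSet hw hθ,
      isExternal_affineSet _, ?_, (abbImage_affineSet F K _).symm⟩
    exact (smallestTangentDegree_lineSet_iff hw hθ (le_adjoin_of_notMem hnpp hθ) r).2 hdeg
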